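/- Let $F$ and $G$ be real locally convex Souslin topological vector spaces with their Borel $\sigma$-algebras, and let $X$, $Z$, $\gamma$ be independent random variables on a probability space $(\Omega,\Sigma,P)$, where $X$ is $F$-valued, $Z$ is $G$-valued zero-mean Gaussian with infinite-dimensional Cameron--Martin space $H=H_{\mu_Z}\subset G$, and $\gamma\ge 0$ is real-valued with $P(\gamma=0)=0$. Let $C_Z$ be the covariance operator of $Z$, regarded as an isometry from $H'$ (the closure of $G'$ in $L^2(\mu_Z)$) onto $H$, so that $\psi(C_Zg)=\int g\,\psi\,d\mu_Z$ for all $\psi\in G'$ and $\|h\|_H=\|C_Z^{-1}h\|_{L^2(\mu_Z)}$. Let $L:F\to G$ be continuous with $L(F)\subset H$, let $(e_i)_{i\ge1}$ be an orthonormal basis of $H$ with $C_Z^{-1}e_i\in G'$, and set $Y=L(X)+\gamma Z$. A posterior distribution of $X$ given $Y$ is a family $(\mu(\cdot,y))_{y\in G}$ of Borel probability measures on $F$ such that, for every Borel set $A\subset F$, the function $y\mapsto\mu(A,y)$ is $\mu_Y$-measurable and $\mu(A,Y)=\mathbf E[1_A(X)\mid\sigma(Y)]$ $P$-a.s. For $h\in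 H$, a version of $\langle\cdot,C_Z^{-1}h\rangle$ is a function on $G$ which is $\mu_Z$-a.e. equal to the element $C_Z^{-1}h$ of $L^2(\mu_Z)$ and which is linear on some linear subspace of $G$ of full $\mu_Z$-measure. Then: 1. $\lim_{n\to\infty}\frac1n\sum_{i=1}^n\langle Y,C_Z^{-1}e_i\rangle^2=\gamma^2$ $P$-almost surely. 2. The posterior distribution of $X$ given $Y$ is essentially unique: any two posterior distributions agree for $\mu_Y$-almost every $y$. 3. There is a jointly Borel measurable function $(x,y)\mapsto\langle y,C_Z^{-1}L(x)\rangle$ on $F\times G$ which, for every $x\in F$, is a version of the pairing with $C_Z^{-1}L(x)$. 4. For every choice of such a function, there is a posterior distribution $\mu$ of $X$ given $Y$ such that $$\mu(A,y)=\frac{\int_A\exp\left(\gamma_y^{-2}\langle y,C_Z^{-1}L(x)\rangle-\frac1{2\gamma_y^2}\|L(x)\|_{H}^2\right)d\mu_X(x)}{\int_F\exp\left(\gamma_y^{-2}\langle y,C_Z^{-1}L(x)\rangle-\frac1{2\gamma_y^2}\|L(x)\|_{H}^2\right)d\mu_X(x)}$$ for all Borel sets $A\subset F$ and all $y\in G$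 such that the limit $\gamma_y=\left(\lim_{n\to\infty}\frac1n\sum_{i=1}^n\langle y,C_Z^{-1}e_i\rangle^2\right)^{1/2}$ exists, is finite and nonzero, and the denominator is finite. The set of these $y$ has full $\mu_Y$-measure. -/

import Mathlib

open MeasureTheory ProbabilityTheory Filter Topology
open scoped ENNReal

noncomputable section

/-! ### The Cameron–Martin space of a centred Gaussian measure -/

/-- The closure in `L²(μ)` of the (classes of) continuous linear functionals on `G`. For a centred
Gaussian measure `μ` with covariance operator `C`, one has `‖φ‖²_{L²(μ)} = ⟨Cφ, φ⟩`, so this is the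
completion of `G'` in the covariance norm, i.e. the dual `H'` of the Cameron–Martin space. -/
def dualClosure {G : Type*} [AddCommGroup G] [Module ℝ G] [TopologicalSpace G]
    [MeasurableSpace G] (μ : Measure G) : Submodule ℝ (Lp ℝ 2 μ) :=
  (Submodule.span ℝ {g : Lp ℝ 2 μ | ∃ φ : StrongDual ℝ G, g =ᵐ[μ] φ}).topologicalClosure

/-- `h = C g`, where `C` is the covariance operator of the centred measure `μ`, extended from `G'`
to the closure of `G'` in `L²(μ)`:  `⟨C g, ψ⟩ = ∫ g ψ dμ` for all `ψ ∈ G'`. -/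
def IsCovarianceImage {G : Type*} [AddCommGroup G] [Module ℝ G] [TopologicalSpace G]
    [MeasurableSpace G] (μ : Measure G) (g : Lp ℝ 2 μ) (h : G) : Prop :=
  g ∈ dualClosure μ ∧ ∀ ψ : StrongDual ℝ G, ψ h = ∫ z, g z * ψ z ∂μ

theorem memLp_two_dual {G : Type*} [AddCommGroup G] [Module ℝ G] [TopologicalSpace G]
    [MeasurableSpace G] [BorelSpace G] (μ : Measure G) [IsGaussian μ] (ψ : StrongDual ℝ G) :
    MemLp ψ 2 μ := by
  have h : MemLp (id : ℝ → ℝ) 2 (μ.map ψ) := by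
    rw [IsGaussian.map_eq_gaussianReal]
    exact memLp_id_gaussianReal 2
  have hψ : AEMeasurable ψ μ := by fun_prop
  exact (memLp_map_measure_iff (f := ψ) aestronglyMeasurable_id hψ).1 h

theorem integrable_mul_dual {G : Type*} [AddCommGroup G] [Module ℝ G] [TopologicalSpace G]
    [MeasurableSpace G] [BorelSpace G] (μ : Measure G) [IsGaussian μ] (g : Lp ℝ 2 μ)
    (ψ : StrongDual ℝ G) : Integrable (fun z => g z * ψ z) μ :=
  (Lp.memLp g).integrable_mul (memLp_two_dual μ ψ)

/-- The Cameron–Martin space `H_μ ⊆ G` of a centred Gaussian measure `μ`, as a vector space: the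
range of the covariance operator on the closure of `G'` in `L²(μ)`. -/
def cameronMartin {G : Type*} [AddCommGroup G] [Module ℝ G] [TopologicalSpace G]
    [MeasurableSpace G] [BorelSpace G] (μ : Measure G) [IsGaussian μ] : Submodule ℝ G where
  carrier := {h | ∃ g : Lp ℝ 2 μ, IsCovarianceImage μ g h}
  zero_mem' := by
    refine ⟨0, Submodule.zero_mem _, fun ψ => ?_⟩
    rw [map_zero, integral_eq_zero_of_ae]
    filter_upwards [Lp.coeFn_zero ℝ 2 μ] with z hz
    simp only [hz, Pi.zero_apply, zero_mul]
  add_mem' := by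
    rintro a b ⟨f, hf, hf'⟩ ⟨g, hg, hg'⟩
    refine ⟨f + g, Submodule.add_mem _ hf hg, fun ψ => ?_⟩
    rw [map_add, hf', hg', ← integral_add (integrable_mul_dual μ f ψ) (integrable_mul_dual μ g ψ)]
    refine integral_congr_ae ?_
    filter_upwards [Lp.coeFn_add f g] with z hz
    simp only [hz, Pi.add_apply, add_mul]
  smul_mem' := by
    rintro c a ⟨f, hf, hf'⟩
    refine ⟨c • f, Submodule.smul_mem _ c hf, fun ψ => ?_⟩
    rw [map_smul, hf', smul_eq_mul, ← integral_const_mul]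
    refine integral_congr_ae ?_
    filter_upwards [Lp.coeFn_smul c f] with z hz
    simp only [hz, Pi.smul_apply, smul_eq_mul, mul_assoc]

/-- `g ∈ H'` is determined by `C g`. -/
theorem IsCovarianceImage.unique {G : Type*} [AddCommGroup G] [Module ℝ G] [TopologicalSpace G]
    [MeasurableSpace G] [BorelSpace G] (μ : Measure G) [IsGaussian μ] {f g : Lp ℝ 2 μ} {h : G}
    (hf : IsCovarianceImage μ f h) (hg : IsCovarianceImage μ g h) : f = g := by
  have key : f - g ∈ (dualClosure μ)ᗮ := by
    rw [dualClosure, Submodule.orthogonal_closure, Submodule.mem_orthogonal]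
    intro u hu
    induction hu using Submodule.span_induction with
    | mem u hu =>
      obtain ⟨ψ, hψ⟩ := hu
      have h1 : ∫ z, f z * ψ z - g z * ψ z ∂μ = 0 := by
        rw [integral_sub (integrable_mul_dual μ f ψ) (integrable_mul_dual μ g ψ), ← hf.2 ψ,
          ← hg.2 ψ, sub_self]
      rw [L2.inner_def, ← h1]
      refine integral_congr_ae ?_
      filter_upwards [hψ, Lp.coeFn_sub f g] with z hz hz'
      simp only [hz, hz', Pi.sub_apply, RCLike.inner_apply, sub_mul]
      simp
    | zero => simp
    | add u v _ _ hu hv => rw [inner_add_left, hu, hv, add_zero]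
    | smul c u _ hu => rw [inner_smul_left, hu, mul_zero]
  have h0 : f - g = 0 :=
    inner_self_eq_zero.1 (key (f - g) (Submodule.sub_mem _ hf.1 hg.1) : inner ℝ (f - g) (f - g) = 0)
  exact sub_eq_zero.1 h0

/-- The Cameron–Martin space as a type of its own, which carries the Hilbert norm of `H_μ` and not
the topology that it inherits from `G`. -/
def CameronMartin {G : Type*} [AddCommGroup G] [Module ℝ G] [TopologicalSpace G]
    [MeasurableSpace G] [BorelSpace G] (μ : Measure G) [IsGaussian μ] : Type _ :=
  cameronMartin μ

namespace CameronMartin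

instance {G : Type*} [AddCommGroup G] [Module ℝ G] [TopologicalSpace G]
    [MeasurableSpace G] [BorelSpace G] (μ : Measure G) [IsGaussian μ] :
    AddCommGroup (CameronMartin μ) :=
  inferInstanceAs (AddCommGroup (cameronMartin μ))

instance {G : Type*} [AddCommGroup G] [Module ℝ G] [TopologicalSpace G]
    [MeasurableSpace G] [BorelSpace G] (μ : Measure G) [IsGaussian μ] :
    Module ℝ (CameronMartin μ) :=
  inferInstanceAs (Module ℝ (cameronMartin μ))

/-- The inclusion `H_μ → G`. -/
def incl {G : Type*} [AddCommGroup G] [Module ℝ G] [TopologicalSpace G]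
    [MeasurableSpace G] [BorelSpace G] (μ : Measure G) [IsGaussian μ] : CameronMartin μ →ₗ[ℝ] G :=
  (cameronMartin μ).subtype

/-- An element of `G` that lies in `H_μ`, as an element of the Hilbert space `H_μ`. -/
def mk {G : Type*} [AddCommGroup G] [Module ℝ G] [TopologicalSpace G]
    [MeasurableSpace G] [BorelSpace G] (μ : Measure G) [IsGaussian μ] (h : G)
    (hh : h ∈ cameronMartin μ) : CameronMartin μ :=
  ⟨h, hh⟩

theorem exists_rep {G : Type*} [AddCommGroup G] [Module ℝ G] [TopologicalSpace G]
    [MeasurableSpace G] [BorelSpace G] (μ : Measure G) [IsGaussian μ] (h : CameronMartin μ) :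
    ∃ g : Lp ℝ 2 μ, IsCovarianceImage μ g (incl μ h) :=
  h.2

/-- `C⁻¹ : H_μ → H' ⊆ L²(μ)`: the unique `g` in the `L²(μ)`-closure of `G'` with `C g = h`. -/
def covInv {G : Type*} [AddCommGroup G] [Module ℝ G] [TopologicalSpace G]
    [MeasurableSpace G] [BorelSpace G] (μ : Measure G) [IsGaussian μ] :
    CameronMartin μ →ₗ[ℝ] Lp ℝ 2 μ where
  toFun h := (exists_rep μ h).choose
  map_add' a b := by
    refine IsCovarianceImage.unique μ (exists_rep μ (a + b)).choose_spec ?_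
    obtain ⟨hf, hf'⟩ := (exists_rep μ a).choose_spec
    obtain ⟨hg, hg'⟩ := (exists_rep μ b).choose_spec
    refine ⟨Submodule.add_mem _ hf hg, fun ψ => ?_⟩
    rw [map_add, map_add, hf', hg',
      ← integral_add (integrable_mul_dual μ _ ψ) (integrable_mul_dual μ _ ψ)]
    refine integral_congr_ae ?_
    filter_upwards [Lp.coeFn_add (exists_rep μ a).choose (exists_rep μ b).choose] with z hz
    simp only [hz, Pi.add_apply, add_mul]
  map_smul' c a := by
    refine IsCovarianceImage.unique μ (exists_rep μ (c • a)).choose_spec ?_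
    obtain ⟨hf, hf'⟩ := (exists_rep μ a).choose_spec
    refine ⟨Submodule.smul_mem _ c hf, fun ψ => ?_⟩
    rw [map_smul, map_smul, hf', smul_eq_mul, ← integral_const_mul]
    refine integral_congr_ae ?_
    filter_upwards [Lp.coeFn_smul c (exists_rep μ a).choose] with z hz
    rw [RingHom.id_apply]
    simp only [hz, Pi.smul_apply, smul_eq_mul, mul_assoc]

theorem covInv_spec {G : Type*} [AddCommGroup G] [Module ℝ G] [TopologicalSpace G]
    [MeasurableSpace G] [BorelSpace G] (μ : Measure G) [IsGaussian μ] (h : CameronMartin μ) :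
    IsCovarianceImage μ (covInv μ h) (incl μ h) :=
  (exists_rep μ h).choose_spec

theorem covInv_injective {G : Type*} [AddCommGroup G] [Module ℝ G] [TopologicalSpace G]
    [IsTopologicalAddGroup G] [ContinuousSMul ℝ G] [LocallyConvexSpace ℝ G] [T2Space G]
    [MeasurableSpace G] [BorelSpace G] (μ : Measure G) [IsGaussian μ] :
    Function.Injective (covInv μ) := by
  intro a b hab
  refine Subtype.ext ?_
  by_contra hne
  obtain ⟨ψ, hψ⟩ := geometric_hahn_banach_point_point (E := G) hne
  refine hψ.ne ?_
  have h1 := (covInv_spec μ a).2 ψ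
  have h2 := (covInv_spec μ b).2 ψ
  rw [hab, ← h2] at h1
  exact h1

/-- The norm of `H_μ`: `‖h‖ = ‖C⁻¹ h‖_{L²(μ)}`. -/
instance {G : Type*} [AddCommGroup G] [Module ℝ G] [TopologicalSpace G]
    [IsTopologicalAddGroup G] [ContinuousSMul ℝ G] [LocallyConvexSpace ℝ G] [T2Space G]
    [MeasurableSpace G] [BorelSpace G] (μ : Measure G) [IsGaussian μ] :
    NormedAddCommGroup (CameronMartin μ) :=
  NormedAddCommGroup.induced (CameronMartin μ) (Lp ℝ 2 μ) (covInv μ) (covInv_injective μ)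

/-- The inner product of `H_μ`: `⟪h, k⟫ = ⟪C⁻¹ h, C⁻¹ k⟫_{L²(μ)}`. -/
instance {G : Type*} [AddCommGroup G] [Module ℝ G] [TopologicalSpace G]
    [IsTopologicalAddGroup G] [ContinuousSMul ℝ G] [LocallyConvexSpace ℝ G] [T2Space G]
    [MeasurableSpace G] [BorelSpace G] (μ : Measure G) [IsGaussian μ] :
    InnerProductSpace ℝ (CameronMartin μ) where
  norm_smul_le c a := by
    change ‖covInv μ (c • a)‖ ≤ ‖c‖ * ‖covInv μ a‖
    rw [map_smul, norm_smul]
  inner a b := inner ℝ (covInv μ a) (covInv μ b)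
  norm_sq_eq_re_inner a := norm_sq_eq_re_inner (𝕜 := ℝ) (covInv μ a)
  conj_inner_symm a b := inner_conj_symm (covInv μ a) (covInv μ b)
  add_left a b c := by simp only [map_add, inner_add_left]
  smul_left a b r := by simp only [map_smul, inner_smul_left]

end CameronMartin

/-- `f : G → ℝ` is a version of `y ↦ ⟨y, C⁻¹ h⟩`, the measurable linear extension of the duality:
`f` represents `C⁻¹ h ∈ L²(μ)` and is linear on some linear subspace of full `μ`-measure. -/
def IsDualityVersion {G : Type*} [AddCommGroup G] [Module ℝ G] [TopologicalSpace G]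
    [MeasurableSpace G] [BorelSpace G] (μ : Measure G) [IsGaussian μ]
    (h : CameronMartin μ) (f : G → ℝ) : Prop :=
  f =ᵐ[μ] CameronMartin.covInv μ h ∧
  ∃ V : Submodule ℝ G, (∀ᵐ y ∂μ, y ∈ V) ∧
    (∀ y ∈ V, ∀ z ∈ V, f (y + z) = f y + f z) ∧ ∀ (r : ℝ), ∀ y ∈ V, f (r • y) = r * f y

/-! ### Posterior distributions -/

/-- `ν` is a solution of the statistical inverse problem of estimating the distribution of `X`
given `Y`; `ν y` is the posterior distribution of `X` given `Y = y`. -/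
structure IsPosterior {Ω F G : Type*} [MeasurableSpace Ω] [MeasurableSpace F]
    [mG : MeasurableSpace G] (P : Measure Ω) (X : Ω → F) (Y : Ω → G) (ν : G → Measure F) :
    Prop where
  isProbabilityMeasure : ∀ y, IsProbabilityMeasure (ν y)
  aemeasurable : ∀ U, MeasurableSet U → AEMeasurable (fun y => ν y U) (P.map Y)
  condExp : ∀ U, MeasurableSet U →
    (fun ω => (ν (Y ω)).real U) =ᵐ[P] P[(X ⁻¹' U).indicator (fun _ => (1 : ℝ)) | mG.comap Y]

/-! ### Spherically invariant noise -/

/-- `(1/n) ∑_{i=1}^n ⟨y, φ_i⟩²`. -/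
def empiricalVariance {G : Type*} [AddCommGroup G] [Module ℝ G] [TopologicalSpace G]
    (φ : ℕ → StrongDual ℝ G) (y : G) (n : ℕ) : ℝ :=
  (n : ℝ)⁻¹ * ∑ i ∈ Finset.range n, (φ i y) ^ 2

/-- The Gaussian Cameron–Martin likelihood with variance `c²`:
`exp (c⁻² ⟨y, C⁻¹ h⟩ - ‖h‖²_H / (2 c²))`, where `t` is the value of `⟨y, C⁻¹ h⟩`. -/
def cmLikelihood {H : Type*} [Norm H] (c : ℝ) (t : ℝ) (h : H) : ℝ≥0∞ :=
  ENNReal.ofReal (Real.exp ((c ^ 2)⁻¹ * t - ‖h‖ ^ 2 / (2 * c ^ 2)))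

end

/-!
The observation `Y = L X + γ Z` determines its own noise scale. In the coordinates `φᵢ = C⁻¹ eᵢ` the
noise is `γ` times a sequence of independent standard Gaussian variables, while the coordinates of
`L X ∈ H` are square summable by Bessel's inequality. So the strong law of large numbers gives
`(1/n) ∑ ⟨Y, φᵢ⟩² → γ²` (`CameronMartin.ae_tendsto_empiricalVariance`,
`tendsto_mean_sq_add_of_summable`), and `γ` may be replaced by a measurable function `noiseScale` of
the observation.

Given `γ = c` and `X = x`, the observation is the noise `c Z` shifted by `L x ∈ H`, and the
Cameron–Martin formula (`IsCovarianceImage.map_add_eq_withDensity`) gives its density with respect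
to the law of `c Z` (`IsDualityVersion.measure_add_smul_mem`). The laws of `c Z` for different `c`
are mutually singular, but since `c` is a function of the observation these densities glue to a single
density of `Y` given `X = x` with respect to the law of `γ Z` (`prod_joint_eq_lintegral`). This
dominated situation is covered by Bayes' formula (`isPosterior_bayesKernel`).

The Cameron–Martin formula is proved by comparing characteristic functionals. These determine a
measure on a Souslin space, whose Borel `σ`-algebra is generated by countably many continuous
functionals (`MeasureTheory.AnalyticSet.exists_seq_dual_comap_eq`). The same fact makes `L x + c z`
jointly measurable in `(c, x, z)`, and it makes the `σ`-algebra of `F` countably generated, whence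
the posterior is essentially unique (`IsPosterior.ae_eq`).

A jointly measurable version of `⟨y, C⁻¹ L x⟩` is the series `∑ ⟨L x, φᵢ⟩ ⟨y, φᵢ⟩`
(`gaussianSeries`). It converges almost surely as an `L²`-bounded martingale, and its limit is
`C⁻¹ L x` because `e` is an orthonormal basis of the Cameron–Martin space.
-/

/-! ### Souslin locally convex spaces -/

section Souslin

/-- Comparable countably separated `σ`-algebras on the image of a standard Borel space coincide:
both are the final `σ`-algebra. -/
theorem MeasurableSpace.eq_of_le_of_countablySeparated {S E : Type*} [MeasurableSpace S]
    [StandardBorelSpace S] {m₁ m₂ : MeasurableSpace E} (hle : m₁ ≤ m₂)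
    (h₁ : @MeasurableSpace.CountablySeparated E m₁) {f : S → E} (hf : @Measurable _ _ _ m₂ f)
    (hsurj : Function.Surjective f) : m₁ = m₂ := by
  have h₂ : @MeasurableSpace.CountablySeparated E m₂ := MeasurableSpace.CountablySeparated.mono hle
  have e₁ := @Measurable.map_measurableSpace_eq _ _ _ _ m₁ h₁ f (hf.mono le_rfl hle) hsurj
  have e₂ := @Measurable.map_measurableSpace_eq _ _ _ _ m₂ h₂ f hf hsurj
  exact e₁.symm.trans e₂

variable {E : Type*} [AddCommGroup E] [Module ℝ E] [TopologicalSpace E] [IsTopologicalAddGroup E]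
  [ContinuousSMul ℝ E] [LocallyConvexSpace ℝ E] [T2Space E]

/-- The square of a Souslin space is a continuous image of a second countable space, so the open
sets `{(x, y) | ψ x ≠ ψ y}`, which cover the complement of the diagonal by Hahn–Banach, have a
countable subcover. -/
theorem MeasureTheory.AnalyticSet.exists_seq_dual_separating
    (hE : AnalyticSet (Set.univ : Set E)) :
    ∃ ψ : ℕ → StrongDual ℝ E, ∀ x y, (∀ n, ψ n x = ψ n y) → x = y := by
  rw [AnalyticSet] at hE
  obtain h | ⟨f, hf, hfr⟩ := hE
  · exact absurd (h ▸ Set.mem_univ (0 : E)) (Set.notMem_empty _)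
  obtain ⟨T, hT, hTU⟩ := TopologicalSpace.isOpen_iUnion_countable
    (fun ψ : StrongDual ℝ E => {q : (ℕ → ℕ) × (ℕ → ℕ) | ψ (f q.1) ≠ ψ (f q.2)})
    (fun ψ => isOpen_ne_fun (by fun_prop) (by fun_prop))
  have hsep : ∀ x y : E, (∀ ψ ∈ T, ψ x = ψ y) → x = y := by
    intro x y hxy
    by_contra hne
    obtain ⟨ψ, hψ⟩ := geometric_hahn_banach_point_point (E := E) hne
    obtain ⟨s, rfl⟩ : x ∈ Set.range f := hfr ▸ Set.mem_univ x
    obtain ⟨t, rfl⟩ : y ∈ Set.range f := hfr ▸ Set.mem_univ y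
    have hmem : (s, t) ∈ ⋃ ψ : StrongDual ℝ E,
        {q : (ℕ → ℕ) × (ℕ → ℕ) | ψ (f q.1) ≠ ψ (f q.2)} := Set.mem_iUnion.2 ⟨ψ, hψ.ne⟩
    rw [← hTU] at hmem
    obtain ⟨ψ', hψ'T, hψ'⟩ := Set.mem_iUnion₂.1 hmem
    exact hψ' (hxy ψ' hψ'T)
  obtain ⟨ψ, hψ⟩ := (hT.insert 0).exists_eq_range (Set.insert_nonempty _ _)
  refine ⟨ψ, fun x y h => hsep x y fun χ hχ => ?_⟩
  obtain ⟨n, rfl⟩ : χ ∈ Set.range ψ := hψ ▸ Set.mem_insert_of_mem _ hχ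
  exact h n

variable [mE : MeasurableSpace E] [BorelSpace E]

/-- Any sequence of continuous functionals that separates points will do: the `σ`-algebra that it
generates and the Borel `σ`-algebra are both countably separated, hence both are the image of the
Borel `σ`-algebra of `ℕ → ℕ`. -/
theorem MeasureTheory.AnalyticSet.exists_seq_dual_comap_eq
    (hE : AnalyticSet (Set.univ : Set E)) :
    ∃ ψ : ℕ → StrongDual ℝ E, MeasurableSpace.comap (fun x n => ψ n x) MeasurableSpace.pi = mE := by
  obtain ⟨ψ, hψ⟩ := hE.exists_seq_dual_separating
  refine ⟨ψ, ?_⟩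
  rw [AnalyticSet] at hE
  obtain h | ⟨f, hf, hfr⟩ := hE
  · exact absurd (h ▸ Set.mem_univ (0 : E)) (Set.notMem_empty _)
  have hsurj : Function.Surjective f := Set.range_eq_univ.1 hfr
  have hΨ : Measurable fun x n => ψ n x :=
    measurable_pi_lambda _ fun n => (ψ n).continuous.measurable
  have hinj : Function.Injective fun x n => ψ n x := fun x y hxy => hψ x y (congrFun hxy)
  refine MeasurableSpace.eq_of_le_of_countablySeparated hΨ.comap_le ?_
    (hf.measurable : Measurable f) hsurj
  have hcg : @MeasurableSpace.CountablyGenerated E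
      (MeasurableSpace.comap (fun x n => ψ n x) MeasurableSpace.pi) :=
    MeasurableSpace.CountablyGenerated.comap _
  have hsp : @MeasurableSpace.SeparatesPoints E
      (MeasurableSpace.comap (fun x n => ψ n x) MeasurableSpace.pi) := by
    refine @MeasurableSpace.SeparatesPoints.mk E
      (MeasurableSpace.comap (fun x n => ψ n x) MeasurableSpace.pi) fun x y hxy => hinj ?_
    by_contra hne
    exact hne (hxy _ ⟨{(fun n => ψ n x)}, measurableSet_singleton _, rfl⟩ rfl).symm
  exact @MeasurableSpace.countablySeparated_of_separatesPoints E
    (MeasurableSpace.comap (fun x n => ψ n x) MeasurableSpace.pi) hcg hsp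

theorem MeasureTheory.AnalyticSet.countablyGenerated_borel
    (hE : AnalyticSet (Set.univ : Set E)) : MeasurableSpace.CountablyGenerated E := by
  obtain ⟨ψ, hψ⟩ := hE.exists_seq_dual_comap_eq
  rw [← hψ]
  exact MeasurableSpace.CountablyGenerated.comap _

/-- Scalarly measurable maps into a Souslin space are measurable. -/
theorem MeasureTheory.AnalyticSet.measurable_of_dual (hE : AnalyticSet (Set.univ : Set E))
    {S : Type*} [MeasurableSpace S] {f : S → E}
    (hf : ∀ ψ : StrongDual ℝ E, Measurable fun s => ψ (f s)) : Measurable f := by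
  obtain ⟨ψ, hψ⟩ := hE.exists_seq_dual_comap_eq
  rw [← hψ, measurable_comap_iff]
  exact measurable_pi_lambda _ fun n => hf (ψ n)

/-- A finite measure on a Souslin space is determined by its characteristic functional. -/
theorem MeasureTheory.AnalyticSet.measure_ext_of_charFun (hE : AnalyticSet (Set.univ : Set E))
    {μ ν : Measure E} [IsFiniteMeasure μ] [IsFiniteMeasure ν]
    (h : ∀ ψ : StrongDual ℝ E,
      ∫ x, Complex.exp (ψ x * Complex.I) ∂μ = ∫ x, Complex.exp (ψ x * Complex.I) ∂ν) :
    μ = ν := by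
  obtain ⟨ψ, hψ⟩ := hE.exists_seq_dual_comap_eq
  have hΨ : Measurable fun x n => ψ n x :=
    measurable_pi_lambda _ fun n => (ψ n).continuous.measurable
  have hmap : μ.map (fun x n => ψ n x) = ν.map (fun x n => ψ n x) := by
    have key : ∀ I : Finset ℕ, (μ.map (fun x n => ψ n x)).map I.restrict =
        (ν.map (fun x n => ψ n x)).map I.restrict := by
      intro I
      rw [Measure.map_map (by fun_prop) hΨ, Measure.map_map (by fun_prop) hΨ]
      refine Measure.ext_of_charFunDual (funext fun ℓ => ?_)
      have hm : Measurable (I.restrict ∘ fun x n => ψ n x) := by fun_prop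
      simp only [charFunDual_apply]
      rw [integral_map hm.aemeasurable (by fun_prop), integral_map hm.aemeasurable (by fun_prop)]
      exact h (ℓ ∘L ContinuousLinearMap.pi fun i : I => ψ i)
    exact IsProjectiveLimit.unique
      (P := fun I : Finset ℕ => (ν.map (fun x n => ψ n x)).map I.restrict)
      key fun I => rfl
  ext s hs
  rw [← hψ] at hs
  obtain ⟨t, ht, rfl⟩ := hs
  rw [← Measure.map_apply hΨ ht, hmap, Measure.map_apply hΨ ht]

end Souslin

/-! ### The Gaussian Hilbert space and the Cameron–Martin formula -/

section Gaussian

variable {G : Type*} [AddCommGroup G] [Module ℝ G] [TopologicalSpace G]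
  [MeasurableSpace G] [BorelSpace G] {μ : Measure G} [IsGaussian μ]

theorem MeasureTheory.Lp.norm_sq_eq_integral {α : Type*} [MeasurableSpace α] {μ : Measure α}
    (u : Lp ℝ 2 μ) : ‖u‖ ^ 2 = ∫ z, u z ^ 2 ∂μ := by
  rw [← real_inner_self_eq_norm_sq, L2.inner_def]
  exact integral_congr_ae (.of_forall fun z => by simp [pow_two])

theorem MeasureTheory.Lp.inner_eq_integral_mul {α : Type*} [MeasurableSpace α] {μ : Measure α}
    (u v : Lp ℝ 2 μ) : inner ℝ u v = ∫ z, u z * v z ∂μ := by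
  rw [L2.inner_def]
  exact integral_congr_ae (.of_forall fun z => by simp [mul_comm])

theorem dual_toLp_mem_dualClosure (ψ : StrongDual ℝ G) :
    (memLp_two_dual μ ψ).toLp ψ ∈ dualClosure μ :=
  Submodule.le_topologicalClosure _ <| Submodule.subset_span ⟨ψ, (memLp_two_dual μ ψ).coeFn_toLp⟩

theorem integral_norm_Lp_two_le {α : Type*} [MeasurableSpace α] {μ : Measure α}
    [IsProbabilityMeasure μ] (u : Lp ℝ 2 μ) : ∫ z, ‖u z‖ ∂μ ≤ ‖u‖ := by
  rw [Lp.norm_def, integral_norm_eq_lintegral_enorm (Lp.aestronglyMeasurable u),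
    ← eLpNorm_one_eq_lintegral_enorm]
  exact ENNReal.toReal_mono (Lp.eLpNorm_ne_top u)
    (eLpNorm_le_eLpNorm_of_exponent_le (by norm_num) (Lp.aestronglyMeasurable u))

theorem continuous_charFun_Lp_two {α : Type*} [MeasurableSpace α] {μ : Measure α}
    [IsProbabilityMeasure μ] :
    Continuous fun u : Lp ℝ 2 μ => ∫ z, Complex.exp (u z * Complex.I) ∂μ := by
  have hint : ∀ w : Lp ℝ 2 μ, Integrable (fun z => Complex.exp (w z * Complex.I)) μ := fun w =>
    Integrable.of_bound
      (((Lp.stronglyMeasurable w).measurable.complex_ofReal.mul_const _).cexp.aestronglyMeasurable)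
      1 (.of_forall fun z => (Complex.norm_exp_ofReal_mul_I _).le)
  refine LipschitzWith.continuous (K := 1) (LipschitzWith.of_dist_le_mul fun u v => ?_)
  rw [dist_eq_norm, dist_eq_norm, ← integral_sub (hint u) (hint v), NNReal.coe_one, one_mul]
  refine (norm_integral_le_integral_norm _).trans ((integral_mono_ae ?_ ?_ ?_).trans
    (integral_norm_Lp_two_le (u - v)))
  · exact ((hint u).sub (hint v)).norm
  · exact ((Lp.memLp (u - v)).integrable (by norm_num)).norm
  · filter_upwards [Lp.coeFn_sub u v] with z hz
    have h1 : Complex.exp (u z * Complex.I) - Complex.exp (v z * Complex.I) =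
        Complex.exp (v z * Complex.I) * (Complex.exp (Complex.I * ((u z - v z : ℝ) : ℂ)) - 1) := by
      rw [mul_sub, ← Complex.exp_add, mul_one]
      congr 2
      push_cast
      ring
    simp only [hz, Pi.sub_apply]
    rw [h1, norm_mul, Complex.norm_exp_ofReal_mul_I, one_mul]
    exact Real.norm_exp_I_mul_ofReal_sub_one_le

theorem map_dual_eq_gaussianReal (hmean : ∀ ψ : StrongDual ℝ G, ∫ z, ψ z ∂μ = 0)
    (ψ : StrongDual ℝ G) :
    μ.map ψ = gaussianReal 0 (∫ z, ψ z ^ 2 ∂μ).toNNReal := by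
  rw [IsGaussian.map_eq_gaussianReal, hmean ψ,
    variance_of_integral_eq_zero (by fun_prop) (hmean ψ)]

theorem integral_cexp_of_map_eq_gaussianReal {α : Type*} [MeasurableSpace α] {ν : Measure α}
    {f : α → ℝ} {s : ℝ} (hs : 0 ≤ s) (hf : ν.map f = gaussianReal 0 s.toNNReal) (w : ℂ) :
    ∫ z, Complex.exp (w * f z) ∂ν = Complex.exp (s * w ^ 2 / 2) := by
  have h := complexMGF_gaussianReal hf w
  simp only [complexMGF, Complex.ofReal_zero, mul_zero, zero_add] at h
  rw [h, show ((s.toNNReal : ℝ) : ℂ) = (s : ℂ) by rw [Real.coe_toNNReal _ hs]]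

/-- Every element of the closure of `G'` in `L²(μ)` is centred Gaussian: the characteristic function
at `1` depends continuously on `u ∈ L²(μ)`. -/
theorem integral_cexp_of_mem_dualClosure (hmean : ∀ ψ : StrongDual ℝ G, ∫ z, ψ z ∂μ = 0)
    {u : Lp ℝ 2 μ} (hu : u ∈ dualClosure μ) :
    ∫ z, Complex.exp (u z * Complex.I) ∂μ = Complex.exp (-(‖u‖ : ℂ) ^ 2 / 2) := by
  have hclosed : IsClosed {u : Lp ℝ 2 μ |
      ∫ z, Complex.exp (u z * Complex.I) ∂μ = Complex.exp (-(‖u‖ : ℂ) ^ 2 / 2)} :=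
    isClosed_eq continuous_charFun_Lp_two (by fun_prop)
  refine closure_minimal (fun v hv => ?_) hclosed hu
  obtain ⟨ψ, hψ⟩ : ∃ ψ : StrongDual ℝ G, v =ᵐ[μ] ψ := by
    induction hv using Submodule.span_induction with
    | mem v hv => exact hv
    | zero => exact ⟨0, Lp.coeFn_zero ℝ 2 μ⟩
    | add v w _ _ hv hw =>
      obtain ⟨ψ, hψ⟩ := hv
      obtain ⟨χ, hχ⟩ := hw
      exact ⟨ψ + χ, (Lp.coeFn_add v w).trans (hψ.add hχ)⟩
    | smul c v _ hv =>
      obtain ⟨ψ, hψ⟩ := hv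
      exact ⟨c • ψ, (Lp.coeFn_smul c v).trans (hψ.const_smul c)⟩
  have hnorm : ‖v‖ ^ 2 = ∫ z, ψ z ^ 2 ∂μ := by
    rw [Lp.norm_sq_eq_integral]
    exact integral_congr_ae (hψ.mono fun z hz => by simp only [hz])
  have h := integral_cexp_of_map_eq_gaussianReal
    (integral_nonneg fun z => sq_nonneg (ψ z)) (map_dual_eq_gaussianReal hmean ψ) Complex.I
  rw [← hnorm] at h
  calc ∫ z, Complex.exp (v z * Complex.I) ∂μ = ∫ z, Complex.exp (Complex.I * ψ z) ∂μ :=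
        integral_congr_ae (hψ.mono fun z hz => by simp only [hz, mul_comm])
    _ = Complex.exp (-(‖v‖ : ℂ) ^ 2 / 2) := by
        rw [h]
        congr 1
        push_cast
        rw [Complex.I_sq]
        ring

theorem charFun_map_of_mem_dualClosure (hmean : ∀ ψ : StrongDual ℝ G, ∫ z, ψ z ∂μ = 0)
    {u : Lp ℝ 2 μ} (hu : u ∈ dualClosure μ) (t : ℝ) :
    charFun (μ.map u) t = Complex.exp (-(t * ‖u‖ : ℂ) ^ 2 / 2) := by
  have h := integral_cexp_of_mem_dualClosure hmean (Submodule.smul_mem _ t hu)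
  rw [charFun_apply_real, integral_map (Lp.stronglyMeasurable u).measurable.aemeasurable
    (by fun_prop)]
  calc _ = ∫ z, Complex.exp ((t • u) z * Complex.I) ∂μ := by
        refine integral_congr_ae ?_
        filter_upwards [Lp.coeFn_smul t u] with z hz
        simp [hz]
    _ = _ := by
        rw [h, norm_smul, Real.norm_eq_abs]
        congr 3
        rw [← Complex.ofReal_pow, mul_pow, sq_abs]
        push_cast
        ring

theorem map_eq_gaussianReal_of_mem_dualClosure
    (hmean : ∀ ψ : StrongDual ℝ G, ∫ z, ψ z ∂μ = 0) {u : Lp ℝ 2 μ} (hu : u ∈ dualClosure μ) :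
    μ.map u = gaussianReal 0 (‖u‖ ^ 2).toNNReal := by
  have := Measure.isProbabilityMeasure_map (μ := μ)
    (Lp.stronglyMeasurable u).measurable.aemeasurable
  refine Measure.ext_of_charFun (funext fun t => ?_)
  rw [charFun_map_of_mem_dualClosure hmean hu, charFun_gaussianReal,
    Real.coe_toNNReal _ (sq_nonneg _)]
  congr 1
  push_cast
  ring

/-- Orthogonal elements of the Gaussian Hilbert space are independent. -/
theorem indepFun_of_mem_dualClosure (hmean : ∀ ψ : StrongDual ℝ G, ∫ z, ψ z ∂μ = 0)
    {u v : Lp ℝ 2 μ} (hu : u ∈ dualClosure μ) (hv : v ∈ dualClosure μ) (huv : inner ℝ u v = 0) :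
    IndepFun u v μ := by
  have hum := (Lp.stronglyMeasurable u).measurable
  have hvm := (Lp.stronglyMeasurable v).measurable
  rw [indepFun_iff_charFun_prod hum.aemeasurable hvm.aemeasurable]
  intro t
  set a := t.ofLp.1
  set b := t.ofLp.2
  have hnorm : ‖a • u + b • v‖ ^ 2 = (a * ‖u‖) ^ 2 + (b * ‖v‖) ^ 2 := by
    rw [norm_add_sq_real, norm_smul, norm_smul, inner_smul_left, inner_smul_right, huv, mul_pow,
      mul_pow, mul_pow, mul_pow, Real.norm_eq_abs, Real.norm_eq_abs, sq_abs, sq_abs]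
    ring
  have h := integral_cexp_of_mem_dualClosure hmean
    (Submodule.add_mem _ (Submodule.smul_mem _ a hu) (Submodule.smul_mem _ b hv))
  rw [charFun_map_of_mem_dualClosure hmean hu, charFun_map_of_mem_dualClosure hmean hv,
    charFun_apply, integral_map (by fun_prop) (by fun_prop), ← Complex.exp_add]
  calc _ = ∫ z, Complex.exp ((a • u + b • v : Lp ℝ 2 μ) z * Complex.I) ∂μ := by
        refine integral_congr_ae ?_
        filter_upwards [Lp.coeFn_add (a • u) (b • v), Lp.coeFn_smul a u, Lp.coeFn_smul b v]
          with z h1 h2 h3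
        rw [h1, Pi.add_apply, h2, h3]
        simp [WithLp.prod_inner_apply, a, b]
    _ = _ := by
        rw [h, ← Complex.ofReal_pow, hnorm]
        congr 1
        push_cast
        ring

/-- The Fourier transform of the density in the Cameron–Martin formula. With `ψ = a g + r`, `r ⟂ g`,
the integral factors into a Gaussian characteristic function and a Gaussian moment generating
function at the complex point `1 + a i`. -/
theorem integral_cexp_mul_exp_of_mem_dualClosure (hmean : ∀ ψ : StrongDual ℝ G, ∫ z, ψ z ∂μ = 0)
    {g v : Lp ℝ 2 μ} (hg : g ∈ dualClosure μ) (hv : v ∈ dualClosure μ) :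
    ∫ z, Complex.exp (v z * Complex.I) * Complex.exp (g z - ‖g‖ ^ 2 / 2) ∂μ =
      Complex.exp (inner ℝ g v * Complex.I) * Complex.exp (-(‖v‖ : ℂ) ^ 2 / 2) := by
  obtain ⟨a, ha⟩ : ∃ a : ℝ, inner ℝ g v = a * ‖g‖ ^ 2 := by
    rcases eq_or_ne g 0 with rfl | h0
    · exact ⟨0, by simp⟩
    · exact ⟨inner ℝ g v / ‖g‖ ^ 2, by field_simp [norm_ne_zero_iff.2 h0]⟩
  set r := v - a • g with hr
  have hrmem : r ∈ dualClosure μ := Submodule.sub_mem _ hv (Submodule.smul_mem _ a hg)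
  have hrg : inner ℝ r g = 0 := by
    rw [hr, inner_sub_left, inner_smul_left, real_inner_self_eq_norm_sq, real_inner_comm, ha]
    simp
  have hnorm : ‖v‖ ^ 2 = ‖r‖ ^ 2 + a ^ 2 * ‖g‖ ^ 2 := by
    have : v = r + a • g := by rw [hr]; abel
    rw [this, norm_add_sq_real, inner_smul_right, hrg, norm_smul, mul_pow, Real.norm_eq_abs, sq_abs]
    ring
  have hrm := (Lp.stronglyMeasurable r).measurable
  have hgm := (Lp.stronglyMeasurable g).measurable
  have hprod := (indepFun_of_mem_dualClosure hmean hrmem hg hrg).integral_fun_comp_mul_comp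
    (f := fun x : ℝ => Complex.exp (x * Complex.I))
    (g := fun x : ℝ => Complex.exp ((1 + a * Complex.I) * x))
    hrm.aemeasurable hgm.aemeasurable (by fun_prop) (by fun_prop)
  rw [integral_cexp_of_mem_dualClosure hmean hrmem, integral_cexp_of_map_eq_gaussianReal
    (sq_nonneg ‖g‖) (map_eq_gaussianReal_of_mem_dualClosure hmean hg), ← Complex.exp_add] at hprod
  calc _ = ∫ z, (Complex.exp (r z * Complex.I) * Complex.exp ((1 + a * Complex.I) * g z)) *
        Complex.exp (-(‖g‖ : ℂ) ^ 2 / 2) ∂μ := by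
        refine integral_congr_ae ?_
        filter_upwards [Lp.coeFn_sub v (a • g), Lp.coeFn_smul a g] with z h1 h2
        rw [hr, h1, Pi.sub_apply, h2, Pi.smul_apply, smul_eq_mul, ← Complex.exp_add,
          ← Complex.exp_add, ← Complex.exp_add]
        congr 1
        push_cast
        ring
    _ = _ := by
        rw [integral_mul_const, hprod, ← Complex.exp_add, ← Complex.exp_add, ha,
          ← Complex.ofReal_pow ‖v‖, hnorm]
        congr 1
        push_cast
        linear_combination (a ^ 2 * ‖g‖ ^ 2 / 2 : ℂ) * Complex.I_sq

theorem lintegral_exp_of_mem_dualClosure (hmean : ∀ ψ : StrongDual ℝ G, ∫ z, ψ z ∂μ = 0)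
    {g : Lp ℝ 2 μ} (hg : g ∈ dualClosure μ) :
    ∫⁻ z, ENNReal.ofReal (Real.exp (g z - ‖g‖ ^ 2 / 2)) ∂μ = 1 := by
  have hmap := map_eq_gaussianReal_of_mem_dualClosure hmean hg
  have hgm := (Lp.stronglyMeasurable g).measurable
  have hint : Integrable (fun z => Real.exp (g z)) μ := by
    have h := integrable_exp_mul_gaussianReal (μ := 0) (v := (‖g‖ ^ 2).toNNReal) 1
    rw [← hmap] at h
    simpa [Function.comp_def] using h.comp_measurable hgm
  have hmgf := mgf_gaussianReal hmap 1
  simp only [mgf, one_mul] at hmgf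
  rw [← ofReal_integral_eq_lintegral_ofReal _ (.of_forall fun z => (Real.exp_pos _).le)]
  · simp_rw [Real.exp_sub]
    rw [integral_div, hmgf, Real.coe_toNNReal _ (sq_nonneg _)]
    simp
  · simp_rw [Real.exp_sub]
    exact hint.div_const _

/-- The **Cameron–Martin formula**. -/
theorem IsCovarianceImage.map_add_eq_withDensity [IsTopologicalAddGroup G] [ContinuousSMul ℝ G]
    [LocallyConvexSpace ℝ G] [T2Space G] (hG : AnalyticSet (Set.univ : Set G))
    (hmean : ∀ ψ : StrongDual ℝ G, ∫ z, ψ z ∂μ = 0)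
    {g : Lp ℝ 2 μ} {h : G} (hgh : IsCovarianceImage μ g h) :
    μ.map (fun z => h + z) =
      μ.withDensity fun z => ENNReal.ofReal (Real.exp (g z - ‖g‖ ^ 2 / 2)) := by
  have hgm := (Lp.stronglyMeasurable g).measurable
  have : IsFiniteMeasure (μ.withDensity fun z => ENNReal.ofReal (Real.exp (g z - ‖g‖ ^ 2 / 2))) :=
    isFiniteMeasure_withDensity (by
      rw [lintegral_exp_of_mem_dualClosure hmean hgh.1]; exact ENNReal.one_ne_top)
  have hadd : Measurable fun z : G => h + z := (continuous_const.add continuous_id).measurable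
  refine hG.measure_ext_of_charFun fun ψ => ?_
  set v := (memLp_two_dual μ ψ).toLp ψ
  have hvψ : v =ᵐ[μ] ψ := (memLp_two_dual μ ψ).coeFn_toLp
  have hv : v ∈ dualClosure μ := dual_toLp_mem_dualClosure ψ
  have hinner : inner ℝ g v = ψ h := by
    rw [Lp.inner_eq_integral_mul, hgh.2 ψ]
    exact integral_congr_ae (hvψ.mono fun z hz => by simp only [hz])
  rw [integral_map hadd.aemeasurable (by fun_prop),
    integral_withDensity_eq_integral_toReal_smul (by fun_prop)
      (.of_forall fun z => ENNReal.ofReal_lt_top)]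
  calc _ = ∫ z, Complex.exp (ψ h * Complex.I) * Complex.exp (v z * Complex.I) ∂μ := by
        refine integral_congr_ae (hvψ.mono fun z hz => ?_)
        simp only [map_add, hz, ← Complex.exp_add]
        congr 1
        push_cast
        ring
    _ = Complex.exp (inner ℝ g v * Complex.I) * Complex.exp (-(‖v‖ : ℂ) ^ 2 / 2) := by
        rw [integral_const_mul, integral_cexp_of_mem_dualClosure hmean hv, hinner]
    _ = _ := by
        rw [← integral_cexp_mul_exp_of_mem_dualClosure hmean hgh.1 hv]
        refine integral_congr_ae (hvψ.mono fun z hz => ?_)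
        simp only [hz, ENNReal.toReal_ofReal (Real.exp_pos _).le, Complex.real_smul]
        push_cast
        ring

end Gaussian

/-! ### Orthonormal expansions and quadratic means -/

theorem Orthonormal.hasSum_inner_smul_of_mem_closure {ι E : Type*} [NormedAddCommGroup E]
    [InnerProductSpace ℝ E] [CompleteSpace E] {f : ι → E} (hf : Orthonormal ℝ f) {v : E}
    (hv : v ∈ (Submodule.span ℝ (Set.range f)).topologicalClosure) :
    HasSum (fun i => (inner ℝ (f i) v : ℝ) • f i) v := by
  have hs : Summable fun i => (inner ℝ (f i) v : ℝ) • f i :=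
    (hf.orthogonalFamily.summable_iff_norm_sq_summable fun i => (inner ℝ (f i) v : ℝ)).2
      (hf.inner_products_summable v)
  obtain ⟨w, hw⟩ := hs
  have hwmem : w ∈ (Submodule.span ℝ (Set.range f)).topologicalClosure :=
    (Submodule.isClosed_topologicalClosure _).mem_of_tendsto hw <| .of_forall fun s =>
      Submodule.sum_mem _ fun i _ => Submodule.smul_mem _ _ <|
        Submodule.le_topologicalClosure _ (Submodule.subset_span ⟨i, rfl⟩)
  have hcoord : ∀ j, inner ℝ (f j) (v - w) = 0 := by
    intro j
    have h1 := hw.mapL (innerSL ℝ (f j))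
    have h2 : HasSum (fun i => innerSL ℝ (f j) ((inner ℝ (f i) v : ℝ) • f i))
        (inner ℝ (f j) v) := by
      classical
      convert! hasSum_ite_eq j (inner ℝ (f j) v : ℝ) using 2 with i
      rw [innerSL_apply_apply, inner_smul_right, orthonormal_iff_ite.1 hf]
      rcases eq_or_ne i j with rfl | hij
      · simp
      · simp [hij, hij.symm]
    rw [inner_sub_right, sub_eq_zero]
    exact h2.unique h1
  have horth : v - w ∈ (Submodule.span ℝ (Set.range f)).topologicalClosureᗮ := by
    rw [Submodule.orthogonal_closure, Submodule.mem_orthogonal]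
    intro u hu
    induction hu using Submodule.span_induction with
    | mem u hu => obtain ⟨j, rfl⟩ := hu; exact hcoord j
    | zero => simp
    | add a b _ _ ha hb => rw [inner_add_left, ha, hb, add_zero]
    | smul c a _ ha => rw [inner_smul_left, ha, mul_zero]
  have h0 : v - w = 0 := inner_self_eq_zero.1 (horth _ (Submodule.sub_mem _ hv hwmem) :
    inner ℝ (v - w) (v - w) = 0)
  have hwv : w = v := (sub_eq_zero.1 h0).symm
  rwa [hwv] at hw

/-- A square summable perturbation does not change the quadratic mean of a sequence: the mixed term
is controlled by `2 |a b| ≤ ε b² + a² / ε`. -/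
theorem tendsto_mean_sq_add_of_summable {a b : ℕ → ℝ} (ha : Summable fun i => a i ^ 2)
    (c : ℝ) {l : ℝ}
    (hb : Tendsto (fun n : ℕ => (n : ℝ)⁻¹ * ∑ i ∈ Finset.range n, b i ^ 2) atTop (𝓝 l)) :
    Tendsto (fun n : ℕ => (n : ℝ)⁻¹ * ∑ i ∈ Finset.range n, (a i + c * b i) ^ 2) atTop
      (𝓝 (c ^ 2 * l)) := by
  have hA : Tendsto (fun n : ℕ => (n : ℝ)⁻¹ * ∑ i ∈ Finset.range n, a i ^ 2) atTop (𝓝 0) := by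
    simpa using tendsto_inv_atTop_nhds_zero_nat.mul ha.hasSum.tendsto_sum_nat
  have hM : Tendsto (fun n : ℕ => (n : ℝ)⁻¹ * ∑ i ∈ Finset.range n, a i * b i) atTop (𝓝 0) := by
    have hsqrt := ((hA.mul hb).sqrt)
    rw [zero_mul, Real.sqrt_zero] at hsqrt
    refine squeeze_zero_norm (fun n => ?_) hsqrt
    rw [Real.norm_eq_abs]
    refine Real.abs_le_sqrt ?_
    have hcs := Finset.sum_mul_sq_le_sq_mul_sq (Finset.range n) a b
    calc _ = ((n : ℝ)⁻¹) ^ 2 * (∑ i ∈ Finset.range n, a i * b i) ^ 2 := by ring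
      _ ≤ ((n : ℝ)⁻¹) ^ 2 * ((∑ i ∈ Finset.range n, a i ^ 2) * ∑ i ∈ Finset.range n, b i ^ 2) := by
        gcongr
      _ = _ := by ring
  have h := (hA.add (hM.const_mul (2 * c))).add (hb.const_mul (c ^ 2))
  simp only [mul_zero, zero_add] at h
  refine h.congr fun n => ?_
  simp only [add_sq, Finset.sum_add_distrib, mul_pow, ← Finset.mul_sum, mul_add]
  have : ∑ i ∈ Finset.range n, 2 * a i * (c * b i) =
      2 * c * ∑ i ∈ Finset.range n, a i * b i := by
    rw [Finset.mul_sum]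
    exact Finset.sum_congr rfl fun i _ => by ring
  rw [this]
  ring

/-! ### Gaussian coordinates -/

section Coordinates

/-- The functional `ψ ∈ G'` represents `C⁻¹ h`. -/
theorem CameronMartin.covInv_ae_eq_dual {G : Type*} [AddCommGroup G] [Module ℝ G]
    [TopologicalSpace G] [MeasurableSpace G] [BorelSpace G] {μ : Measure G} [IsGaussian μ]
    {h : CameronMartin μ} {ψ : StrongDual ℝ G}
    (hψ : ∀ χ : StrongDual ℝ G, χ (incl μ h) = ∫ z, ψ z * χ z ∂μ) : covInv μ h =ᵐ[μ] ψ := by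
  have hae := (memLp_two_dual μ ψ).coeFn_toLp
  have : covInv μ h = (memLp_two_dual μ ψ).toLp ψ := by
    refine IsCovarianceImage.unique μ (covInv_spec μ h) ⟨dual_toLp_mem_dualClosure ψ, fun χ => ?_⟩
    rw [hψ]
    exact integral_congr_ae (hae.mono fun z hz => by simp only [hz])
  rw [this]
  exact hae

variable {G : Type*} [AddCommGroup G] [Module ℝ G] [TopologicalSpace G]
  [IsTopologicalAddGroup G] [ContinuousSMul ℝ G] [LocallyConvexSpace ℝ G] [T2Space G]
  [MeasurableSpace G] [BorelSpace G] {μ : Measure G} [IsGaussian μ]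

theorem CameronMartin.inner_eq (a b : CameronMartin μ) :
    inner ℝ a b = inner ℝ (covInv μ a) (covInv μ b) := rfl

theorem CameronMartin.norm_eq (a : CameronMartin μ) : ‖a‖ = ‖covInv μ a‖ := rfl

/-- The isometric embedding `C⁻¹ : H → L²(μ)`. -/
noncomputable def CameronMartin.covInvIsometry (μ : Measure G) [IsGaussian μ] :
    CameronMartin μ →ₗᵢ[ℝ] Lp ℝ 2 μ where
  toLinearMap := covInv μ
  norm_map' _ := rfl

theorem CameronMartin.dual_incl_eq_inner {h : CameronMartin μ} {ψ : StrongDual ℝ G}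
    (hψ : ∀ χ : StrongDual ℝ G, χ (incl μ h) = ∫ z, ψ z * χ z ∂μ) (k : CameronMartin μ) :
    ψ (incl μ k) = inner ℝ h k := by
  rw [inner_eq, real_inner_comm, Lp.inner_eq_integral_mul, (covInv_spec μ k).2 ψ]
  exact integral_congr_ae ((covInv_ae_eq_dual hψ).mono fun z hz => by simp only [hz])

variable {e : ℕ → CameronMartin μ} {φ : ℕ → StrongDual ℝ G}

theorem CameronMartin.integral_dual_mul_dual
    (hφ : ∀ i, ∀ ψ : StrongDual ℝ G, ψ (incl μ (e i)) = ∫ z, φ i z * ψ z ∂μ)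
    (he : Orthonormal ℝ e) (i j : ℕ) :
    ∫ z, φ i z * φ j z ∂μ = if i = j then 1 else 0 := by
  rw [← hφ i (φ j), dual_incl_eq_inner (hφ j), orthonormal_iff_ite.1 he]
  simp only [eq_comm]

theorem CameronMartin.hasSum_covInv
    (hφ : ∀ i, ∀ ψ : StrongDual ℝ G, ψ (incl μ (e i)) = ∫ z, φ i z * ψ z ∂μ)
    (he : Orthonormal ℝ e) (he_total : (Submodule.span ℝ (Set.range e)).topologicalClosure = ⊤)
    (h : CameronMartin μ) :
    HasSum (fun i => φ i (incl μ h) • covInv μ (e i)) (covInv μ h) := by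
  have hf : Orthonormal ℝ fun i => covInv μ (e i) :=
    he.comp_linearIsometry (covInvIsometry μ)
  have hmem : covInv μ h ∈
      (Submodule.span ℝ (Set.range fun i => covInv μ (e i))).topologicalClosure := by
    have h1 : h ∈ closure (Submodule.span ℝ (Set.range e) : Set (CameronMartin μ)) := by
      rw [← Submodule.topologicalClosure_coe, he_total]
      trivial
    refine map_mem_closure (covInvIsometry μ).continuous h1 fun k hk => ?_
    have h2 := Submodule.mem_map_of_mem (f := covInv μ) hk
    rw [Submodule.map_span, ← Set.range_comp] at h2
    exact h2
  refine (hf.hasSum_inner_smul_of_mem_closure hmem).congr_fun fun i => ?_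
  rw [dual_incl_eq_inner (hφ i), inner_eq]

theorem CameronMartin.hasSum_sq_norm
    (hφ : ∀ i, ∀ ψ : StrongDual ℝ G, ψ (incl μ (e i)) = ∫ z, φ i z * ψ z ∂μ)
    (he : Orthonormal ℝ e) (he_total : (Submodule.span ℝ (Set.range e)).topologicalClosure = ⊤)
    (h : CameronMartin μ) :
    HasSum (fun i => φ i (incl μ h) ^ 2) (‖h‖ ^ 2) := by
  have h1 := (hasSum_covInv hφ he he_total h).mapL (innerSL ℝ (covInv μ h))
  rw [innerSL_apply_apply, real_inner_self_eq_norm_sq] at h1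
  refine h1.congr_fun fun i => ?_
  rw [innerSL_apply_apply, inner_smul_right, ← inner_eq, real_inner_comm,
    ← dual_incl_eq_inner (hφ i), pow_two]

theorem CameronMartin.iIndepFun_coordinates (hmean : ∀ ψ : StrongDual ℝ G, ∫ z, ψ z ∂μ = 0)
    (hφ : ∀ i, ∀ ψ : StrongDual ℝ G, ψ (incl μ (e i)) = ∫ z, φ i z * ψ z ∂μ)
    (he : Orthonormal ℝ e) : iIndepFun (fun i z => φ i z) μ := by
  have hproc : IsGaussianProcess (fun (p : (_ : ℕ) × Unit) z => φ p.1 z) μ := by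
    refine ⟨fun I => ⟨?_⟩⟩
    let ℓ : G →L[ℝ] (I → ℝ) := ContinuousLinearMap.pi fun p => φ p.1.1
    exact isGaussian_map_of_measurable (L := ℓ) (measurable_pi_lambda _ fun p =>
      (φ p.1.1).continuous.measurable)
  have h := hproc.iIndepFun_of_covariance_eq_zero (X := fun i (_ : Unit) z => φ i z)
    (fun i _ => (φ i).continuous.measurable.aemeasurable) fun i j hij _ _ => by
      rw [covariance_eq_sub (memLp_two_dual μ (φ i)) (memLp_two_dual μ (φ j)), hmean, hmean,
        mul_zero, sub_zero]
      exact (integral_dual_mul_dual hφ he i j).trans (if_neg hij)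
  exact h.comp (fun _ f => f ()) fun _ => measurable_pi_apply ()

/-- The strong law of large numbers for the independent standard Gaussian variables `φ i`. -/
theorem CameronMartin.ae_tendsto_empiricalVariance
    (hmean : ∀ ψ : StrongDual ℝ G, ∫ z, ψ z ∂μ = 0)
    (hφ : ∀ i, ∀ ψ : StrongDual ℝ G, ψ (incl μ (e i)) = ∫ z, φ i z * ψ z ∂μ)
    (he : Orthonormal ℝ e) :
    ∀ᵐ z ∂μ, Tendsto (empiricalVariance φ z) atTop (𝓝 1) := by
  have hsq : ∀ i, ∫ z, φ i z ^ 2 ∂μ = 1 := fun i => by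
    simpa [pow_two] using integral_dual_mul_dual hφ he i i
  have hlaw : ∀ i, μ.map (φ i) = gaussianReal 0 1 := fun i => by
    rw [map_dual_eq_gaussianReal hmean, hsq, Real.toNNReal_one]
  have h := strong_law_ae_real (fun i z => φ i z ^ 2) (memLp_two_dual μ (φ 0)).integrable_sq
    (fun i j hij => ((iIndepFun_coordinates hmean hφ he).indepFun hij).comp
      (φ := fun x : ℝ => x ^ 2) (ψ := fun x : ℝ => x ^ 2) (by fun_prop) (by fun_prop))
    (fun i => (IdentDistrib.mk (by fun_prop) (by fun_prop) ((hlaw i).trans (hlaw 0).symm) :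
      IdentDistrib (φ i) (φ 0) μ μ).comp (u := fun x : ℝ => x ^ 2) (by fun_prop))
  filter_upwards [h] with z hz
  rw [hsq] at hz
  refine hz.congr fun n => ?_
  rw [empiricalVariance, div_eq_inv_mul]

theorem CameronMartin.tendsto_empiricalVariance_add_smul
    (hφ : ∀ i, ∀ ψ : StrongDual ℝ G, ψ (incl μ (e i)) = ∫ z, φ i z * ψ z ∂μ)
    (he : Orthonormal ℝ e) (he_total : (Submodule.span ℝ (Set.range e)).topologicalClosure = ⊤)
    (h : CameronMartin μ) (c : ℝ) {z : G} (hz : Tendsto (empiricalVariance φ z) atTop (𝓝 1)) :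
    Tendsto (empiricalVariance φ (incl μ h + c • z)) atTop (𝓝 (c ^ 2)) := by
  have := tendsto_mean_sq_add_of_summable (hasSum_sq_norm hφ he he_total h).summable c hz
  rw [mul_one] at this
  refine this.congr fun n => ?_
  simp only [empiricalVariance, map_add, map_smul, smul_eq_mul]

end Coordinates

/-! ### Measurable versions of the duality pairing -/

/-- `L²`-bounded martingale convergence for a weighted sum of independent centred variables. -/
theorem ProbabilityTheory.iIndepFun.ae_exists_tendsto_sum_range {Ω : Type*} [MeasurableSpace Ω]
    {P : Measure Ω} {X : ℕ → Ω → ℝ} (hX : ∀ i, Measurable (X i)) (hind : iIndepFun X P)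
    (hint : ∀ i, Integrable (X i) P) (hmean : ∀ i, ∫ ω, X i ω ∂P = 0) {R : NNReal}
    (hR : ∀ n, eLpNorm (∑ i ∈ Finset.range n, X i) 1 P ≤ R) :
    ∀ᵐ ω ∂P, ∃ l, Tendsto (fun n => ∑ i ∈ Finset.range n, X i ω) atTop (𝓝 l) := by
  have : IsProbabilityMeasure P := hind.isProbabilityMeasure
  have hXs : ∀ i, StronglyMeasurable (X i) := fun i => (hX i).stronglyMeasurable
  set 𝒢 := Filtration.natural X hXs
  have hmart : Martingale (fun n => ∑ i ∈ Finset.range (n + 1), X i) 𝒢 P := by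
    refine martingale_of_condExp_sub_eq_zero_nat (fun n => ?_) (fun n => ?_) (fun n => ?_)
    · refine Finset.stronglyMeasurable_sum _ fun i hi => ?_
      exact ((Filtration.stronglyAdapted_natural hXs) i).mono
        (𝒢.mono (Nat.lt_succ_iff.1 (Finset.mem_range.1 hi)))
    · exact integrable_finsetSum' _ fun i _ => hint i
    · rw [Finset.sum_range_succ_sub_sum]
      refine (iIndepFun.condExp_natural_ae_eq_of_lt hXs hind (Nat.lt_succ_self n)).trans ?_
      exact .of_forall fun ω => hmean _
  filter_upwards [hmart.submartingale.ae_tendsto_limitProcess fun n => hR (n + 1)] with ω hω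
  refine ⟨_, (tendsto_add_atTop_iff_nat 1).1 (hω.congr fun n => ?_)⟩
  rw [Finset.sum_apply]

/-- The Gaussian series `∑ᵢ ⟨h, φᵢ⟩ ⟨y, φᵢ⟩`, which represents `⟨y, C⁻¹ h⟩` when `φᵢ = C⁻¹ eᵢ` for
an orthonormal basis `e` of the Cameron–Martin space. At points `y` where the series diverges the
value is the arbitrary one of `limUnder`. -/
noncomputable def gaussianSeries {G : Type*} [AddCommGroup G] [Module ℝ G] [TopologicalSpace G]
    (φ : ℕ → StrongDual ℝ G) (h y : G) : ℝ :=
  limUnder atTop fun n : ℕ => ∑ i ∈ Finset.range n, φ i h * φ i y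

section Version

variable {G : Type*} [AddCommGroup G] [Module ℝ G] [TopologicalSpace G] {φ : ℕ → StrongDual ℝ G}

theorem Measurable.gaussianSeries [MeasurableSpace G] [BorelSpace G] {S : Type*}
    [MeasurableSpace S] {f g : S → G} (hf : Measurable f) (hg : Measurable g) :
    Measurable fun s => gaussianSeries φ (f s) (g s) := by
  have hm : ∀ i, Measurable (φ i) := fun i => (φ i).continuous.measurable
  refine StronglyMeasurable.measurable (StronglyMeasurable.limUnder fun n =>
    Measurable.stronglyMeasurable ?_)
  exact Finset.measurable_sum _ fun i _ => ((hm i).comp hf).mul ((hm i).comp hg)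

theorem gaussianSeries_add {h y z : G}
    (hy : ∃ l, Tendsto (fun n : ℕ => ∑ i ∈ Finset.range n, φ i h * φ i y) atTop (𝓝 l))
    (hz : ∃ l, Tendsto (fun n : ℕ => ∑ i ∈ Finset.range n, φ i h * φ i z) atTop (𝓝 l)) :
    Tendsto (fun n : ℕ => ∑ i ∈ Finset.range n, φ i h * φ i (y + z)) atTop
      (𝓝 (gaussianSeries φ h y + gaussianSeries φ h z)) :=
  ((tendsto_nhds_limUnder hy).add (tendsto_nhds_limUnder hz)).congr fun n => by
    rw [← Finset.sum_add_distrib]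
    exact Finset.sum_congr rfl fun i _ => by rw [map_add]; ring

theorem gaussianSeries_smul {h y : G} (r : ℝ)
    (hy : ∃ l, Tendsto (fun n : ℕ => ∑ i ∈ Finset.range n, φ i h * φ i y) atTop (𝓝 l)) :
    Tendsto (fun n : ℕ => ∑ i ∈ Finset.range n, φ i h * φ i (r • y)) atTop
      (𝓝 (r * gaussianSeries φ h y)) :=
  ((tendsto_nhds_limUnder hy).const_mul r).congr fun n => by
    rw [Finset.mul_sum]
    exact Finset.sum_congr rfl fun i _ => by rw [map_smul, smul_eq_mul]; ring

variable [MeasurableSpace G] [BorelSpace G] {μ : Measure G} [IsGaussian μ] {e : ℕ → CameronMartin μ}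

theorem CameronMartin.sum_ae_eq
    (hφ : ∀ i, ∀ ψ : StrongDual ℝ G, ψ (incl μ (e i)) = ∫ z, φ i z * ψ z ∂μ)
    (h : G) (n : ℕ) :
    (∑ i ∈ Finset.range n, φ i h • covInv μ (e i) : Lp ℝ 2 μ) =ᵐ[μ]
      fun z => ∑ i ∈ Finset.range n, φ i h * φ i z := by
  have hall : ∀ᵐ z ∂μ, ∀ i, (φ i h • covInv μ (e i) : Lp ℝ 2 μ) z = φ i h * φ i z :=
    ae_all_iff.2 fun i => by
      filter_upwards [Lp.coeFn_smul (φ i h) (covInv μ (e i)), covInv_ae_eq_dual (hφ i)]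
        with z h1 h2
      rw [h1, Pi.smul_apply, h2, smul_eq_mul]
  induction n with
  | zero => simpa using! Lp.coeFn_zero ℝ 2 μ
  | succ n ih =>
    rw [Finset.sum_range_succ]
    filter_upwards [ih, hall, Lp.coeFn_add (∑ i ∈ Finset.range n, φ i h • covInv μ (e i))
      (φ n h • covInv μ (e n))] with z h1 h2 h3
    rw [h3, Pi.add_apply, h1, h2, Finset.sum_range_succ]

variable [IsTopologicalAddGroup G] [ContinuousSMul ℝ G] [LocallyConvexSpace ℝ G] [T2Space G]

theorem CameronMartin.ae_exists_tendsto_gaussianSeries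
    (hmean : ∀ ψ : StrongDual ℝ G, ∫ z, ψ z ∂μ = 0)
    (hφ : ∀ i, ∀ ψ : StrongDual ℝ G, ψ (incl μ (e i)) = ∫ z, φ i z * ψ z ∂μ)
    (he : Orthonormal ℝ e) (h : CameronMartin μ) :
    ∀ᵐ z ∂μ, ∃ l, Tendsto
      (fun n : ℕ => ∑ i ∈ Finset.range n, φ i (incl μ h) * φ i z) atTop (𝓝 l) := by
  have hm : ∀ i, Measurable (φ i) := fun i => (φ i).continuous.measurable
  refine ((iIndepFun_coordinates hmean hφ he).comp (fun i x => φ i (incl μ h) * x)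
    fun i => measurable_const_mul _).ae_exists_tendsto_sum_range (R := ‖h‖₊)
    (fun i => (hm i).const_mul _)
    (fun i => ((memLp_two_dual μ (φ i)).integrable (by norm_num)).const_mul _)
    (fun i => ?_) fun n => ?_
  · exact (integral_const_mul _ _).trans (by rw [hmean, mul_zero])
  -- the `L²` norms are bounded by Bessel's inequality
  have hf : Orthonormal ℝ fun i => covInv μ (e i) := he.comp_linearIsometry (covInvIsometry μ)
  set S : Lp ℝ 2 μ := ∑ i ∈ Finset.range n, φ i (incl μ h) • covInv μ (e i) with hS
  have hSn : ‖S‖ ≤ ‖h‖ := by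
    refine abs_le_of_sq_le_sq' ?_ (norm_nonneg _) |>.2
    rw [hS, ← real_inner_self_eq_norm_sq, hf.inner_sum]
    refine le_trans (le_of_eq ?_) (he.sum_inner_products_le h (s := Finset.range n))
    refine Finset.sum_congr rfl fun i _ => ?_
    rw [dual_incl_eq_inner (hφ i)]
    simp [pow_two]
  have hae :
      (∑ i ∈ Finset.range n, (fun x : ℝ => φ i (incl μ h) * x) ∘ fun z => φ i z) =ᵐ[μ] S := by
    filter_upwards [sum_ae_eq hφ (incl μ h) n] with z hz
    rw [hS, hz, Finset.sum_apply]
    rfl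
  calc eLpNorm (∑ i ∈ Finset.range n, (fun x : ℝ => φ i (incl μ h) * x) ∘ fun z => φ i z) 1 μ
      = eLpNorm S 1 μ := eLpNorm_congr_ae hae
    _ ≤ eLpNorm S 2 μ :=
      eLpNorm_le_eLpNorm_of_exponent_le (by norm_num) (Lp.aestronglyMeasurable S)
    _ = ‖S‖ₑ := (Lp.enorm_def S).symm
    _ ≤ ‖h‖ₑ := by
      rw [← ofReal_norm, ← ofReal_norm]
      exact ENNReal.ofReal_le_ofReal hSn

/-- The Gaussian series converges almost surely by martingale convergence and in `L²` by the
orthonormal expansion of `C⁻¹ h`, and both limits agree. -/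
theorem CameronMartin.isDualityVersion_gaussianSeries
    (hmean : ∀ ψ : StrongDual ℝ G, ∫ z, ψ z ∂μ = 0)
    (hφ : ∀ i, ∀ ψ : StrongDual ℝ G, ψ (incl μ (e i)) = ∫ z, φ i z * ψ z ∂μ)
    (he : Orthonormal ℝ e) (he_total : (Submodule.span ℝ (Set.range e)).topologicalClosure = ⊤)
    (h : CameronMartin μ) : IsDualityVersion μ h (gaussianSeries φ (incl μ h)) := by
  have hconv := ae_exists_tendsto_gaussianSeries hmean hφ he h
  refine ⟨?_, ⟨⟨⟨{y | ∃ l, Tendsto (fun n : ℕ => ∑ i ∈ Finset.range n, φ i (incl μ h) * φ i y)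
    atTop (𝓝 l)}, fun hy hz => ⟨_, gaussianSeries_add hy hz⟩⟩, ⟨0, by simp⟩⟩,
    fun r y hy => ⟨_, gaussianSeries_smul r hy⟩⟩, hconv,
    fun y hy z hz => (gaussianSeries_add hy hz).limUnder_eq,
    fun r y hy => (gaussianSeries_smul r hy).limUnder_eq⟩
  obtain ⟨ns, hns, hlim⟩ := (tendstoInMeasure_of_tendsto_Lp
    (hasSum_covInv hφ he he_total h).tendsto_sum_nat).exists_seq_tendsto_ae
  filter_upwards [hconv, hlim, ae_all_iff.2 (sum_ae_eq hφ (incl μ h))] with z h1 h2 h3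
  refine tendsto_nhds_unique ((tendsto_nhds_limUnder h1).comp hns.tendsto_atTop)
    (h2.congr fun n => ?_)
  exact h3 _

end Version

/-! ### Posterior distributions: uniqueness and Bayes' formula -/

section Posterior

variable {Ω F G : Type*} [MeasurableSpace F]

/-- The normalised density `k(·, y) ξ / ∫ k(x, y) dξ(x)`, and the prior `ξ` itself where the
normalising constant is `0` or `∞`. -/
noncomputable def bayesKernel (ξ : Measure F) (k : F × G → ℝ≥0∞) (y : G) : Measure F :=
  open scoped Classical in
  if ∫⁻ x, k (x, y) ∂ξ = 0 ∨ ∫⁻ x, k (x, y) ∂ξ = ∞ then ξ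
  else (∫⁻ x, k (x, y) ∂ξ)⁻¹ • ξ.withDensity fun x => k (x, y)

theorem bayesKernel_apply {ξ : Measure F} {k : F × G → ℝ≥0∞} {y : G}
    (h0 : ∫⁻ x, k (x, y) ∂ξ ≠ 0) (htop : ∫⁻ x, k (x, y) ∂ξ ≠ ∞) {A : Set F}
    (hA : MeasurableSet A) :
    bayesKernel ξ k y A = (∫⁻ x in A, k (x, y) ∂ξ) / ∫⁻ x, k (x, y) ∂ξ := by
  rw [bayesKernel, if_neg (by simp [h0, htop]), Measure.smul_apply, withDensity_apply _ hA,
    smul_eq_mul, mul_comm, div_eq_mul_inv]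

instance isProbabilityMeasure_bayesKernel (ξ : Measure F) [IsProbabilityMeasure ξ]
    (k : F × G → ℝ≥0∞) (y : G) : IsProbabilityMeasure (bayesKernel ξ k y) := by
  by_cases h : ∫⁻ x, k (x, y) ∂ξ = 0 ∨ ∫⁻ x, k (x, y) ∂ξ = ∞
  · rw [bayesKernel, if_pos h]
    infer_instance
  · rw [not_or] at h
    refine ⟨?_⟩
    rw [bayesKernel_apply h.1 h.2 MeasurableSet.univ, Measure.restrict_univ,
      ENNReal.div_self h.1 h.2]

variable [MeasurableSpace Ω] [mG : MeasurableSpace G]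
  {P : Measure Ω} {X : Ω → F} {Y : Ω → G}

/-- Two posteriors agree almost everywhere on each set of a countable algebra generating the
`σ`-algebra of `F`, hence almost everywhere as measures. -/
theorem IsPosterior.ae_eq [MeasurableSpace.CountablyGenerated F] (hY : Measurable Y)
    {ν ν' : G → Measure F} (hν : IsPosterior P X Y ν) (hν' : IsPosterior P X Y ν') :
    ∀ᵐ y ∂(P.map Y), ν y = ν' y := by
  have hset : ∀ U, MeasurableSet U → ∀ᵐ y ∂(P.map Y), ν y U = ν' y U := by
    intro U hU
    have hnull : NullMeasurableSet {y | ν y U = ν' y U}ᶜ (P.map Y) :=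
      (nullMeasurableSet_eq_fun (hν.aemeasurable U hU) (hν'.aemeasurable U hU)).compl
    rw [ae_iff]
    change P.map Y {y | ν y U = ν' y U}ᶜ = 0
    rw [Measure.map_apply₀ hY.aemeasurable hnull]
    have hae : ∀ᵐ ω ∂P, (ν (Y ω)).real U = (ν' (Y ω)).real U :=
      (hν.condExp U hU).trans (hν'.condExp U hU).symm
    refine measure_mono_null ?_ (ae_iff.1 hae)
    intro ω hω h
    refine hω ?_
    have := hν.isProbabilityMeasure (Y ω)
    have := hν'.isProbabilityMeasure (Y ω)
    exact (measureReal_eq_measureReal_iff (measure_ne_top _ _) (measure_ne_top _ _)).1 h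
  set 𝒮 := generateSetAlgebra (MeasurableSpace.countableGeneratingSet F)
  have hgen : ‹MeasurableSpace F› = MeasurableSpace.generateFrom 𝒮 := by
    rw [generateFrom_generateSetAlgebra_eq, MeasurableSpace.generateFrom_countableGeneratingSet]
  have hcount : 𝒮.Countable :=
    countable_generateSetAlgebra MeasurableSpace.countable_countableGeneratingSet
  have hpi : IsPiSystem 𝒮 := fun s hs t ht _ => isSetAlgebra_generateSetAlgebra.inter_mem hs ht
  have hall := (ae_ball_iff hcount).2 fun U hU =>
    hset U (hgen ▸ MeasurableSpace.measurableSet_generateFrom hU)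
  filter_upwards [hall] with y hy
  have := hν.isProbabilityMeasure y
  have := hν'.isProbabilityMeasure y
  exact ext_of_generate_finite 𝒮 hgen hpi hy (by simp)

theorem measurable_bayesKernel_apply {ξ : Measure F} [SFinite ξ] {k : F × G → ℝ≥0∞}
    (hk : Measurable k) {A : Set F} (hA : MeasurableSet A) :
    Measurable fun y => bayesKernel ξ k y A := by
  have hm : ∀ ζ : Measure F, SFinite ζ → Measurable fun y => ∫⁻ x, k (x, y) ∂ζ :=
    fun ζ _ => hk.lintegral_prod_left'
  have heq : (fun y => bayesKernel ξ k y A) =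
      open scoped Classical in fun y =>
        if ∫⁻ x, k (x, y) ∂ξ = 0 ∨ ∫⁻ x, k (x, y) ∂ξ = ∞ then ξ A
        else (∫⁻ x in A, k (x, y) ∂ξ) / ∫⁻ x, k (x, y) ∂ξ := by
    funext y
    split_ifs with h
    · rw [bayesKernel, if_pos h]
    · rw [not_or] at h
      exact bayesKernel_apply h.1 h.2 hA
  rw [heq]
  refine Measurable.ite ?_ measurable_const ((hm _ inferInstance).div (hm ξ inferInstance))
  exact (hm ξ inferInstance (measurableSet_singleton 0)).union
    (hm ξ inferInstance (measurableSet_singleton ∞))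

variable {ξ : Measure F} {k : F × G → ℝ≥0∞} {lam : Measure G}

theorem map_eq_withDensity_of_joint (hY : Measurable Y)
    (hjoint : ∀ A B, MeasurableSet A → MeasurableSet B →
      P (X ⁻¹' A ∩ Y ⁻¹' B) = ∫⁻ y in B, ∫⁻ x in A, k (x, y) ∂ξ ∂lam) :
    P.map Y = lam.withDensity fun y => ∫⁻ x, k (x, y) ∂ξ := by
  ext B hB
  rw [Measure.map_apply hY hB, withDensity_apply _ hB]
  simpa using hjoint Set.univ B MeasurableSet.univ hB

theorem ae_lintegral_ne_top_of_joint [IsProbabilityMeasure P] [SFinite ξ] (hk : Measurable k)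
    (hjoint : ∀ A B, MeasurableSet A → MeasurableSet B →
      P (X ⁻¹' A ∩ Y ⁻¹' B) = ∫⁻ y in B, ∫⁻ x in A, k (x, y) ∂ξ ∂lam) :
    ∀ᵐ y ∂lam, ∫⁻ x, k (x, y) ∂ξ ≠ ∞ := by
  have h1 := hjoint Set.univ Set.univ MeasurableSet.univ MeasurableSet.univ
  simp only [Set.preimage_univ, Set.inter_self, measure_univ, Measure.restrict_univ] at h1
  exact (ae_lt_top hk.lintegral_prod_left' (h1 ▸ ENNReal.one_ne_top)).mono fun y hy => hy.ne

/-- **Bayes' formula**: if `(X, Y)` has density `k` with respect to `ξ ⊗ λ`, then normalising `k`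
in the first variable gives a posterior distribution. -/
theorem isPosterior_bayesKernel [IsProbabilityMeasure P] [IsProbabilityMeasure ξ]
    (hX : Measurable X) (hY : Measurable Y) (hk : Measurable k)
    (hjoint : ∀ A B, MeasurableSet A → MeasurableSet B →
      P (X ⁻¹' A ∩ Y ⁻¹' B) = ∫⁻ y in B, ∫⁻ x in A, k (x, y) ∂ξ ∂lam) :
    IsPosterior P X Y (bayesKernel ξ k) where
  isProbabilityMeasure y := inferInstance
  aemeasurable U hU := (measurable_bayesKernel_apply hk hU).aemeasurable
  condExp U hU := by
    have hmeas := measurable_bayesKernel_apply (ξ := ξ) hk hU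
    have hcomp : Measurable fun ω => bayesKernel ξ k (Y ω) U := hmeas.comp hY
    have hreal : Measurable fun ω => (bayesKernel ξ k (Y ω)).real U :=
      hcomp.ennreal_toReal
    refine ae_eq_condExp_of_forall_setIntegral_eq hY.comap_le
      ((integrable_const (1 : ℝ)).indicator (hX hU)) (fun s _ _ => ?_) ?_ ?_
    · exact (Integrable.of_bound hreal.aestronglyMeasurable 1 (.of_forall fun ω => by
        rw [Real.norm_of_nonneg measureReal_nonneg]; exact measureReal_le_one)).integrableOn
    · rintro _ ⟨B, hB, rfl⟩ _
      have hD : Measurable fun y => ∫⁻ x, k (x, y) ∂ξ := hk.lintegral_prod_left'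
      have key : ∫⁻ ω in Y ⁻¹' B, bayesKernel ξ k (Y ω) U ∂P = P (X ⁻¹' U ∩ Y ⁻¹' B) := by
        rw [← setLIntegral_map hB hmeas hY, map_eq_withDensity_of_joint hY hjoint,
          setLIntegral_withDensity_eq_setLIntegral_mul _ hD hmeas hB, hjoint U B hU hB]
        refine lintegral_congr_ae (ae_restrict_of_ae ?_)
        filter_upwards [ae_lintegral_ne_top_of_joint hk hjoint] with y hy
        rw [Pi.mul_apply]
        by_cases h0 : ∫⁻ x, k (x, y) ∂ξ = 0
        · rw [h0, zero_mul, eq_comm, ← nonpos_iff_eq_zero, ← h0]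
          exact setLIntegral_le_lintegral _ _
        · rw [bayesKernel_apply h0 hy hU, ENNReal.mul_div_cancel h0 hy]
      simp only [measureReal_def]
      rw [integral_toReal hcomp.aemeasurable
        (.of_forall fun ω => measure_lt_top _ _), key, integral_indicator_const _ (hX hU),
        measureReal_restrict_apply (hX hU), smul_eq_mul, mul_one, measureReal_def]
    · exact (hmeas.ennreal_toReal.comp (comap_measurable Y)).aestronglyMeasurable

end Posterior

/-! ### The joint law of signal and observation -/

section JointLaw

variable {Ω F G : Type*} [MeasurableSpace Ω] {P : Measure Ω} [IsProbabilityMeasure P]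
  [MeasurableSpace F] [MeasurableSpace G]

theorem map_prodMk_eq_prod_of_iIndep {Z : Ω → G} (hZ : Measurable Z) {X : Ω → F} (hX : Measurable X)
    {γ : Ω → ℝ} (hγ : Measurable γ)
    (hindep : iIndep ![MeasurableSpace.comap γ inferInstance, MeasurableSpace.comap X inferInstance,
      MeasurableSpace.comap Z inferInstance] P) :
    P.map (fun ω => ((γ ω, X ω), Z ω)) = ((P.map γ).prod (P.map X)).prod (P.map Z) := by
  have hle : ∀ i, ![MeasurableSpace.comap γ inferInstance, MeasurableSpace.comap X inferInstance,
      MeasurableSpace.comap Z inferInstance] i ≤ ‹MeasurableSpace Ω› := by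
    intro i
    fin_cases i
    exacts [hγ.comap_le, hX.comap_le, hZ.comap_le]
  have h01 : IndepFun γ X P := hindep.indep (i := 0) (j := 1) (by decide)
  have h2 : IndepFun (fun ω => (γ ω, X ω)) Z P := by
    have h := indep_iSup_of_disjoint hle hindep (S := {0, 1}) (T := {2})
      (Set.disjoint_singleton_right.2 (by simp))
    rw [iSup_pair, iSup_singleton] at h
    rw [IndepFun_iff_Indep]
    exact (MeasurableSpace.comap_prodMk γ X).symm ▸ h
  rw [(indepFun_iff_map_prod_eq_prod_map_map (by fun_prop) (by fun_prop)).1 h2,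
    (indepFun_iff_map_prod_eq_prod_map_map (by fun_prop) (by fun_prop)).1 h01]

/-- If, given the signal `x` and the noise scale `c`, the observation `L x + c z` has density
`k (x, ·)` with respect to the law of the noise `c z`, then the joint law of `(x, L x + c z)` has
density `k` with respect to the product of the prior and the law of the noise. -/
theorem prod_joint_eq_lintegral [AddCommGroup G] [Module ℝ G] {ρ : Measure ℝ}
    [IsProbabilityMeasure ρ] {ξ : Measure F} [IsProbabilityMeasure ξ] {μ : Measure G}
    [IsProbabilityMeasure μ] {L : F → G}
    (hLm : Measurable fun q : (ℝ × F) × G => L q.1.2 + q.1.1 • q.2)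
    (hsm : Measurable fun q : ℝ × G => q.1 • q.2) {k : F × G → ℝ≥0∞} (hk : Measurable k)
    {B : Set G} (hB : MeasurableSet B)
    (hshift : ∀ᵐ c ∂ρ, ∀ x, μ {z | L x + c • z ∈ B} = ∫⁻ z in {z | c • z ∈ B}, k (x, c • z) ∂μ)
    {A : Set F} (hA : MeasurableSet A) :
    ((ρ.prod ξ).prod μ) {q | q.1.2 ∈ A ∧ L q.1.2 + q.1.1 • q.2 ∈ B} =
      ∫⁻ y in B, ∫⁻ x in A, k (x, y) ∂ξ ∂((ρ.prod μ).map fun q => q.1 • q.2) := by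
  have hS : MeasurableSet {q : (ℝ × F) × G | q.1.2 ∈ A ∧ L q.1.2 + q.1.1 • q.2 ∈ B} :=
    (measurable_snd.comp measurable_fst hA).inter (hLm hB)
  have hD : Measurable fun y => ∫⁻ x in A, k (x, y) ∂ξ := hk.lintegral_prod_left'
  have hcs : ∀ c : ℝ, Measurable fun z : G => c • z := fun c => hsm.comp measurable_prodMk_left
  have hind : Measurable fun q : ℝ × G => ((fun q : ℝ × G => q.1 • q.2) ⁻¹' B).indicator
      (fun q => ∫⁻ x in A, k (x, q.1 • q.2) ∂ξ) q := (hD.comp hsm).indicator (hsm hB)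
  rw [Measure.prod_apply hS, lintegral_prod _ (measurable_measure_prodMk_left hS).aemeasurable,
    setLIntegral_map hB hD hsm, ← lintegral_indicator (hsm hB),
    lintegral_prod _ hind.aemeasurable]
  refine lintegral_congr_ae ?_
  filter_upwards [hshift] with c hc
  calc ∫⁻ x, μ (Prod.mk (c, x) ⁻¹' {q | q.1.2 ∈ A ∧ L q.1.2 + q.1.1 • q.2 ∈ B}) ∂ξ
      = ∫⁻ x in A, μ {z | L x + c • z ∈ B} ∂ξ := by
        rw [← lintegral_indicator hA]
        refine lintegral_congr fun x => ?_
        by_cases hx : x ∈ A <;> simp [hx]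
    _ = ∫⁻ x in A, ∫⁻ z in {z | c • z ∈ B}, k (x, c • z) ∂μ ∂ξ := by simp_rw [hc]
    _ = ∫⁻ z in {z | c • z ∈ B}, ∫⁻ x in A, k (x, c • z) ∂ξ ∂μ := by
        refine lintegral_lintegral_swap (Measurable.aemeasurable ?_)
        exact hk.comp (measurable_fst.prodMk ((hcs c).comp measurable_snd))
    _ = _ := by
        have hcB : MeasurableSet {z : G | c • z ∈ B} := hcs c hB
        rw [← lintegral_indicator hcB]
        rfl

end JointLaw

section NoiseScale

variable {G : Type*} [AddCommGroup G] [Module ℝ G] [TopologicalSpace G] {φ : ℕ → StrongDual ℝ G}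

/-- The square root of the limit of the empirical variances: the noise scale as a function of the
observation. Where the limit does not exist the value is the arbitrary one of `limUnder`. -/
noncomputable def noiseScale (φ : ℕ → StrongDual ℝ G) (y : G) : ℝ :=
  √(limUnder atTop (empiricalVariance φ y))

theorem noiseScale_eq {y : G} {c : ℝ} (hc : 0 < c)
    (hy : Tendsto (empiricalVariance φ y) atTop (𝓝 (c ^ 2))) : noiseScale φ y = c := by
  rw [noiseScale, hy.limUnder_eq, Real.sqrt_sq hc.le]

variable [MeasurableSpace G] [BorelSpace G]

theorem measurable_empiricalVariance (φ : ℕ → StrongDual ℝ G) (n : ℕ) :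
    Measurable fun y => empiricalVariance φ y n :=
  (Finset.measurable_sum _ fun i _ =>
    ((φ i).continuous.measurable.pow_const 2)).const_mul (n : ℝ)⁻¹

theorem measurable_noiseScale (φ : ℕ → StrongDual ℝ G) : Measurable (noiseScale φ) :=
  (StronglyMeasurable.limUnder fun n =>
    (measurable_empiricalVariance φ n).stronglyMeasurable).measurable.sqrt

end NoiseScale

section Likelihood

variable {F G : Type*} [AddCommGroup G] [Module ℝ G] [TopologicalSpace G]
  [IsTopologicalAddGroup G] [ContinuousSMul ℝ G] [LocallyConvexSpace ℝ G] [T2Space G]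
  [MeasurableSpace G] [BorelSpace G] {μ : Measure G} [IsGaussian μ]

/-- The law of `h + c Z` has the Cameron–Martin likelihood as density with respect to the law of
`c Z`. The linearity of `f` on a subspace of full measure gives its values at `c Z`, whose law may
be singular to that of `Z`. -/
theorem IsDualityVersion.measure_add_smul_mem (hG : AnalyticSet (Set.univ : Set G))
    (hmean : ∀ ψ : StrongDual ℝ G, ∫ z, ψ z ∂μ = 0) {h : CameronMartin μ} {f : G → ℝ}
    (hf : IsDualityVersion μ h f) {c : ℝ} (hc : 0 < c) {B : Set G} (hB : MeasurableSet B) :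
    μ {z | CameronMartin.incl μ h + c • z ∈ B} =
      ∫⁻ z in {z | c • z ∈ B}, cmLikelihood c (f (c • z)) h ∂μ := by
  have hcs : Measurable fun z : G => c • z := (continuous_const_smul c).measurable
  have hB' : MeasurableSet {z : G | c • z ∈ B} := hcs hB
  have hadd : Measurable fun z : G => CameronMartin.incl μ (c⁻¹ • h) + z :=
    (continuous_const.add continuous_id).measurable
  have hset : {z | CameronMartin.incl μ h + c • z ∈ B} =
      (fun z => CameronMartin.incl μ (c⁻¹ • h) + z) ⁻¹' {z | c • z ∈ B} := by
    ext z
    simp only [Set.mem_ofPred_eq, Set.mem_preimage, smul_add, map_smul, smul_inv_smul₀ hc.ne']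
  rw [hset, ← Measure.map_apply hadd hB',
    (CameronMartin.covInv_spec μ (c⁻¹ • h)).map_add_eq_withDensity hG hmean,
    withDensity_apply _ hB']
  obtain ⟨hfae, V, hV, -, hsmul⟩ := hf
  refine lintegral_congr_ae (ae_restrict_of_ae ?_)
  filter_upwards [hfae, hV, Lp.coeFn_smul c⁻¹ (CameronMartin.covInv μ h)] with z h1 h2 h3
  rw [cmLikelihood, hsmul c z h2, h1, ← CameronMartin.norm_eq, norm_smul, map_smul, h3, mul_pow,
    Pi.smul_apply, smul_eq_mul, norm_inv, Real.norm_of_nonneg hc.le]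
  congr 3 <;> field_simp

variable {e : ℕ → CameronMartin μ} {φ : ℕ → StrongDual ℝ G}

theorem measurable_norm_sq_mk [MeasurableSpace F] {L : F → G} (hL : Measurable L)
    (hLH : ∀ x, L x ∈ cameronMartin μ)
    (hφ : ∀ i, ∀ ψ : StrongDual ℝ G, ψ (CameronMartin.incl μ (e i)) = ∫ z, φ i z * ψ z ∂μ)
    (he : Orthonormal ℝ e) (he_total : (Submodule.span ℝ (Set.range e)).topologicalClosure = ⊤) :
    Measurable fun x => ‖CameronMartin.mk μ (L x) (hLH x)‖ ^ 2 := by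
  have hm : ∀ i, Measurable (φ i) := fun i => (φ i).continuous.measurable
  refine measurable_of_tendsto_metrizable
    (f := fun (n : ℕ) x => ∑ i ∈ Finset.range n, φ i (L x) ^ 2)
    (fun n => Finset.measurable_sum _ fun i _ => ((hm i).comp hL).pow_const 2)
    (tendsto_pi_nhds.2 fun x => ?_)
  exact (CameronMartin.hasSum_sq_norm hφ he he_total
    (CameronMartin.mk μ (L x) (hLH x))).tendsto_sum_nat

theorem lintegral_cmLikelihood_ne_zero [MeasurableSpace F] {ξ : Measure F} [IsProbabilityMeasure ξ]
    {H : Type*} [Norm H] {c : ℝ} {t : F → ℝ} {h : F → H}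
    (hm : Measurable fun x => cmLikelihood c (t x) (h x)) :
    ∫⁻ x, cmLikelihood c (t x) (h x) ∂ξ ≠ 0 := by
  rw [Ne, lintegral_eq_zero_iff hm]
  intro h0
  obtain ⟨x, hx⟩ := h0.exists
  exact (ENNReal.ofReal_pos.2 (Real.exp_pos _)).ne' hx

end Likelihood

/-! ### Spherically invariant Gaussian noise -/

theorem mainTheorem10
    {Ω F G : Type*} [MeasurableSpace Ω] (P : Measure Ω) [IsProbabilityMeasure P]
    -- `F` and `G` are real locally convex Souslin spaces with their Borel σ-algebras
    [AddCommGroup F] [Module ℝ F] [TopologicalSpace F] [IsTopologicalAddGroup F]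
    [ContinuousSMul ℝ F] [LocallyConvexSpace ℝ F] [T2Space F] [MeasurableSpace F] [BorelSpace F]
    (hF : AnalyticSet (Set.univ : Set F))
    [AddCommGroup G] [Module ℝ G] [TopologicalSpace G] [IsTopologicalAddGroup G]
    [ContinuousSMul ℝ G] [LocallyConvexSpace ℝ G] [T2Space G] [MeasurableSpace G] [BorelSpace G]
    (hG : AnalyticSet (Set.univ : Set G))
    -- `Z` is zero-mean Gaussian with law `μZ`, with infinite-dimensional Cameron–Martin space
    (Z : Ω → G) (hZ : Measurable Z) (μZ : Measure G) [IsGaussian μZ] (hZμ : P.map Z = μZ)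
    (hmean : ∀ ψ : StrongDual ℝ G, ∫ z, ψ z ∂μZ = 0)
    (hinf : ¬ FiniteDimensional ℝ (CameronMartin μZ))
    (X : Ω → F) (hX : Measurable X)
    (γ : Ω → ℝ) (hγ : Measurable γ) (hγ_nonneg : ∀ ω, 0 ≤ γ ω) (hγ_atom : P {ω | γ ω = 0} = 0)
    -- `γ`, `X`, `Z` are statistically independent
    (hindep : iIndep ![MeasurableSpace.comap γ inferInstance, MeasurableSpace.comap X inferInstance,
      MeasurableSpace.comap Z inferInstance] P)
    (L : F → G) (hL : Continuous L) (hLH : ∀ x, L x ∈ cameronMartin μZ)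
    -- `e` is an orthonormal basis of the Cameron–Martin space with `C⁻¹ eᵢ = φᵢ ∈ G'`
    (e : ℕ → CameronMartin μZ) (he : Orthonormal ℝ e)
    (he_total : (Submodule.span ℝ (Set.range e)).topologicalClosure = ⊤)
    (φ : ℕ → StrongDual ℝ G)
    (hφ : ∀ i, ∀ ψ : StrongDual ℝ G, ψ (CameronMartin.incl μZ (e i)) = ∫ z, φ i z * ψ z ∂μZ)
    (Y : Ω → G) (hY : ∀ ω, Y ω = L (X ω) + γ ω • Z ω) :
    -- the noise scale is recovered from the observation
    (∀ᵐ ω ∂P, Tendsto (empiricalVariance φ (Y ω)) atTop (𝓝 (γ ω ^ 2))) ∧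
    -- the posterior distribution is essentially unique
    (∀ ν ν' : G → Measure F, IsPosterior P X Y ν → IsPosterior P X Y ν' →
      ∀ᵐ y ∂(P.map Y), ν y = ν' y) ∧
    -- there are jointly measurable versions `p x y` of the pairing `⟨y, C⁻¹ L(x)⟩`
    (∃ p : F → G → ℝ, Measurable (Function.uncurry p) ∧
      ∀ x, IsDualityVersion μZ (CameronMartin.mk μZ (L x) (hLH x)) (p x)) ∧
    -- and, with any of them, the Cameron–Martin likelihood yields a posterior distribution
    (∀ p : F → G → ℝ, Measurable (Function.uncurry p) →
      (∀ x, IsDualityVersion μZ (CameronMartin.mk μZ (L x) (hLH x)) (p x)) →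
      (∀ᵐ y ∂(P.map Y), ∃ c : ℝ, 0 < c ∧
        Tendsto (empiricalVariance φ y) atTop (𝓝 (c ^ 2)) ∧
        ∫⁻ x, cmLikelihood c (p x y) (CameronMartin.mk μZ (L x) (hLH x)) ∂(P.map X) ≠ ∞) ∧
      ∃ ν : G → Measure F, IsPosterior P X Y ν ∧
        ∀ (y : G) (c : ℝ), 0 < c →
          Tendsto (empiricalVariance φ y) atTop (𝓝 (c ^ 2)) →
          ∫⁻ x, cmLikelihood c (p x y) (CameronMartin.mk μZ (L x) (hLH x)) ∂(P.map X) ≠ ∞ →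
          ∀ A : Set F, MeasurableSet A →
            ν y A =
              (∫⁻ x in A, cmLikelihood c (p x y) (CameronMartin.mk μZ (L x) (hLH x)) ∂(P.map X)) /
                ∫⁻ x, cmLikelihood c (p x y) (CameronMartin.mk μZ (L x) (hLH x)) ∂(P.map X)) := by
  have : IsProbabilityMeasure (P.map X) := Measure.isProbabilityMeasure_map hX.aemeasurable
  have : IsProbabilityMeasure (P.map γ) := Measure.isProbabilityMeasure_map hγ.aemeasurable
  have hsm : Measurable fun q : ℝ × G => q.1 • q.2 := hG.measurable_of_dual fun ψ => by
    simp only [map_smul, smul_eq_mul]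
    exact measurable_fst.mul (ψ.continuous.measurable.comp measurable_snd)
  have hLm : Measurable fun q : (ℝ × F) × G => L q.1.2 + q.1.1 • q.2 :=
    hG.measurable_of_dual fun ψ => by
      simp only [map_add, map_smul, smul_eq_mul]
      have hψ := ψ.continuous.measurable
      exact (hψ.comp (hL.measurable.comp (measurable_snd.comp measurable_fst))).add
        ((measurable_fst.comp measurable_fst).mul (hψ.comp measurable_snd))
  have hYm : Measurable Y := by
    rw [show Y = fun ω => L (X ω) + γ ω • Z ω from funext hY]
    exact hLm.comp ((hγ.prodMk hX).prodMk hZ)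
  have hγpos : ∀ᵐ ω ∂P, 0 < γ ω := by
    filter_upwards [measure_eq_zero_iff_ae_notMem.1 hγ_atom] with ω hω
    exact lt_of_le_of_ne (hγ_nonneg ω) (Ne.symm hω)
  have hvarZ : ∀ᵐ z ∂μZ, Tendsto (empiricalVariance φ z) atTop (𝓝 1) :=
    CameronMartin.ae_tendsto_empiricalVariance hmean hφ he
  have hvar : ∀ᵐ ω ∂P, Tendsto (empiricalVariance φ (Y ω)) atTop (𝓝 (γ ω ^ 2)) := by
    rw [← hZμ] at hvarZ
    filter_upwards [ae_of_ae_map hZ.aemeasurable hvarZ] with ω hω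
    rw [hY]
    exact CameronMartin.tendsto_empiricalVariance_add_smul hφ he he_total
      (CameronMartin.mk μZ (L (X ω)) (hLH (X ω))) (γ ω) hω
  refine ⟨hvar, ?_, ?_, ?_⟩
  · intro ν ν' hν hν'
    have := hF.countablyGenerated_borel
    exact hν.ae_eq hYm hν'
  · exact ⟨fun x y => gaussianSeries φ (L x) y,
      (hL.measurable.comp measurable_fst).gaussianSeries measurable_snd,
      fun x => CameronMartin.isDualityVersion_gaussianSeries hmean hφ he he_total
        (CameronMartin.mk μZ (L x) (hLH x))⟩
  intro p hp hpv
  -- the likelihood of `x` given `y`, with the noise scale read off from `y`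
  set k : F × G → ℝ≥0∞ := fun q =>
    cmLikelihood (noiseScale φ q.2) (p q.1 q.2) (CameronMartin.mk μZ (L q.1) (hLH q.1)) with hkdef
  have hk : Measurable k := by
    have hn : Measurable fun q : F × G => noiseScale φ q.2 :=
      (measurable_noiseScale φ).comp measurable_snd
    have hq : Measurable fun q : F × G => ‖CameronMartin.mk μZ (L q.1) (hLH q.1)‖ ^ 2 :=
      (measurable_norm_sq_mk hL.measurable hLH hφ he he_total).comp measurable_fst
    exact ((((hn.pow_const 2).inv.mul hp).sub
      (hq.div ((hn.pow_const 2).const_mul 2))).exp).ennreal_ofReal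
  have hjoint : ∀ A B, MeasurableSet A → MeasurableSet B → P (X ⁻¹' A ∩ Y ⁻¹' B) =
      ∫⁻ y in B, ∫⁻ x in A, k (x, y) ∂(P.map X)
        ∂(((P.map γ).prod μZ).map fun q => q.1 • q.2) := by
    intro A B hA hB
    have hS : MeasurableSet {q : (ℝ × F) × G | q.1.2 ∈ A ∧ L q.1.2 + q.1.1 • q.2 ∈ B} :=
      (measurable_snd.comp measurable_fst hA).inter (hLm hB)
    rw [← prod_joint_eq_lintegral hLm hsm hk hB ?_ hA]
    · conv_rhs => rw [← hZμ]
      rw [← map_prodMk_eq_prod_of_iIndep hZ hX hγ hindep,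
        Measure.map_apply ((hγ.prodMk hX).prodMk hZ) hS]
      congr 1
      ext ω
      simp [hY]
    · have hc : ∀ᵐ c ∂(P.map γ), 0 < c :=
        (ae_map_iff hγ.aemeasurable measurableSet_Ioi).2 hγpos
      filter_upwards [hc] with c hc x
      refine ((hpv x).measure_add_smul_mem hG hmean hc hB).trans ?_
      refine lintegral_congr_ae (ae_restrict_of_ae ?_)
      filter_upwards [hvarZ] with z hz
      -- the noise scale read off from the pure noise `c z` is `c`
      have h0 := CameronMartin.tendsto_empiricalVariance_add_smul hφ he he_total 0 c hz
      rw [map_zero, zero_add] at h0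
      simp only [hkdef, noiseScale_eq hc h0]
  refine ⟨?_, bayesKernel (P.map X) k, isPosterior_bayesKernel hX hYm hk hjoint, ?_⟩
  · have htop : ∀ᵐ y ∂(P.map Y), ∫⁻ x, k (x, y) ∂(P.map X) ≠ ∞ := by
      rw [map_eq_withDensity_of_joint hYm hjoint]
      exact (withDensity_absolutelyContinuous _ _).ae_le (ae_lintegral_ne_top_of_joint hk hjoint)
    have hlim : ∀ᵐ y ∂(P.map Y), ∃ c : ℝ, 0 < c ∧
        Tendsto (empiricalVariance φ y) atTop (𝓝 (c ^ 2)) := by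
      have hmeas : MeasurableSet {y | 0 < noiseScale φ y ∧
          ∃ l, Tendsto (empiricalVariance φ y) atTop (𝓝 l)} :=
        (measurableSet_lt measurable_const (measurable_noiseScale φ)).inter
          (StronglyMeasurable.measurableSet_exists_tendsto fun n =>
            (measurable_empiricalVariance φ n).stronglyMeasurable)
      have hae : ∀ᵐ y ∂(P.map Y), 0 < noiseScale φ y ∧
          ∃ l, Tendsto (empiricalVariance φ y) atTop (𝓝 l) := by
        rw [ae_map_iff hYm.aemeasurable hmeas]
        filter_upwards [hvar, hγpos] with ω h1 h2
        exact ⟨by rwa [noiseScale_eq h2 h1], _, h1⟩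
      filter_upwards [hae] with y hy
      refine ⟨noiseScale φ y, hy.1, ?_⟩
      rw [noiseScale, Real.sq_sqrt (Real.sqrt_pos.1 hy.1).le]
      exact tendsto_nhds_limUnder hy.2
    filter_upwards [htop, hlim] with y h1 ⟨c, hc, hyc⟩
    refine ⟨c, hc, hyc, ?_⟩
    simpa only [hkdef, noiseScale_eq hc hyc] using h1
  · intro y c hc hyc hfin A hA
    have hky : ∀ x, k (x, y) = cmLikelihood c (p x y) (CameronMartin.mk μZ (L x) (hLH x)) :=
      fun x => by simp only [hkdef, noiseScale_eq hc hyc]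
    simp only [← hky] at hfin ⊢
    refine bayesKernel_apply ?_ hfin hA
    simp only [hky]
    refine lintegral_cmLikelihood_ne_zero ?_
    simp only [← hky]
    exact hk.comp measurable_prodMk_right
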